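/- Let $F$ be one of the following three meromorphic functions: $$F^{(1)}(z)=\frac{\Gamma(z)}{\prod_{j=1}^r\Gamma(1+\nu_j-z)},\qquad F^{(2)}(z)=\frac{\Gamma(z)\prod_{k\in J}\Gamma(1+\mu_k-z)}{\prod_{j=1}^r\Gamma(1+\nu_j-z)},\qquad F^{(3)}(z)=\frac{\Gamma(z+\frac{\alpha}{2})}{\Gamma\big(\frac{\alpha/2+1-z}{\theta}\big)},$$ where $r\ge 1$ and $\nu_1,\dots,\nu_r\ge 0$ are integers, $J\subsetneq\{1,\dots,r\}$, the $\mu_k$ $(k\in J)$ are integers with $\mu_k>\nu_k$, and $\alpha>-1$, $\theta>0$ are real. Let $\gamma$ and $\tilde\gamma$ be simple unbounded rectifiable contours, oriented upwards, with $\operatorname{Re}u<\frac12$ for $u\in\gamma$ and $\operatorname{Re}v>\frac12$ for $v\in\tilde\gamma$, such that every pole of $F$ lies strictly to the left of $\gamma$ and every zero of $F$ lies strictly to the right of $\tilde\gamma$. The two ends of $\gamma$ tend to infinity inside closed sectors contained, apart from the apex $0$, in the open second quadrant (upper end) and the open third quadrant (lower end); those of $\tilde\gamma$ do so inside closed sectors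 contained, apart from the apex $0$, in the open first quadrant (upper end) and the open fourth quadrant (lower end). The contours have Lipschitz parametrizations $\mathbb R\to\mathbb C$ whose modulus at parameter $t$ is at least $c|t|$ for some $c>0$ and all large $|t|$. For $x,y>0$, $s>0$ and $v,z\in\tilde\gamma$ put $$\mathbb K(x,y)=\frac1{4\pi^2}\int_\gamma du\int_{\tilde\gamma}dv\,\frac{F(u)}{F(v)}\,\frac{x^{-u}y^{v-1}}{u-v},\qquad \mathbb H_s(v,z)=\int_\gamma\frac{du}{2\pi i}\,s^{z-u}\frac{F(u)}{F(v)(v-u)(z-u)}.$$ Both integrals converge absolutely. Let $\mathbb K|_{[0,s]}$ be the integral operator $f\mapsto\int_0^s\mathbb K(x,\cdot)f(x)\,dx$, and let $\mathbb H_s$ be the integral operator $f\mapsto\int_{\tilde\gamma}\mathbb H_s(v,\cdot)f(v)\,\frac{dv}{2\pi i}$ on functions on $\tilde\gamma$. Then their Fredholm determinants, given by the Fredholm series $$\det\big(1-\mathbb K|_{[0,s]}\big)=\sum_{m\ge0}\frac{(-1)^m}{m!}\int_{[0,s]^m}\det\big(\mathbb K(x_i,x_l)\big)_{i,l=1}^m\,dx_1\cdots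 dx_m,$$ $$\det(1-\mathbb H_s)=\sum_{m\ge0}\frac{(-1)^m}{m!}\int_{\tilde\gamma^m}\det\big(\mathbb H_s(v_i,v_l)\big)_{i,l=1}^m\,\frac{dv_1}{2\pi i}\cdots\frac{dv_m}{2\pi i},$$ converge absolutely (all the integrals as well as the series), and $$\det\big(1-\mathbb K|_{[0,s]}\big)=\det\big(1-\mathbb H_s\big).$$ -/

import Mathlib

open MeasureTheory Filter

/-- The three families of parameters. -/
inductive HardEdgeModel : Type
  /-- Products of `r ≥ 1` complex Ginibre matrices with parameters `ν₁, …, ν_r ∈ ℕ ∪ {0}`. -/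
  | ginibre (r : ℕ) (hr : 1 ≤ r) (ν : Fin r → ℕ)
  /-- Products of `r` truncated unitary matrices; `J` is a proper subset of the index set
  (so `q = |J| < r`), and the parameters `μ_k`, `k ∈ J`, satisfy `μ_k > ν_k`. -/
  | truncatedUnitary (r : ℕ) (ν : Fin r → ℕ) (J : Finset (Fin r)) (hJ : J.card < r)
      (μ : J → ℕ) (hμ : ∀ k : J, ν k < μ k)
  /-- Muttalib–Borodin Laguerre ensembles. -/
  | muttalibBorodin (α θ : ℝ) (hα : -1 < α) (hθ : 0 < θ)

/-- The functions `F⁽¹⁾, F⁽²⁾, F⁽³⁾`. -/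
noncomputable def HardEdgeModel.F : HardEdgeModel → ℂ → ℂ
  | .ginibre r _ ν, z =>
      Complex.Gamma z / ∏ j : Fin r, Complex.Gamma (1 + (ν j : ℂ) - z)
  | .truncatedUnitary r ν J _ μ _, z =>
      (Complex.Gamma z * ∏ k : J, Complex.Gamma (1 + (μ k : ℂ) - z)) /
        ∏ j : Fin r, Complex.Gamma (1 + (ν j : ℂ) - z)
  | .muttalibBorodin α θ _ _, z =>
      Complex.Gamma (z + (α : ℂ) / 2) / Complex.Gamma (((α : ℂ) / 2 + 1 - z) / (θ : ℂ))

/-- `p` is a pole of the meromorphic function `F`. -/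
def IsPoleOf (F : ℂ → ℂ) (p : ℂ) : Prop := meromorphicOrderAt F p < 0

/-- `p` is a zero of the meromorphic function `F` (after removal of removable singularities). -/
def IsZeroOf (F : ℂ → ℂ) (p : ℂ) : Prop := 0 < meromorphicOrderAt F p

/-- The points strictly on the same side of the curve `γ` as the point `1/2`: the connected
component of `1/2` in the complement of the curve. -/
def sideOfHalf (γ : ℝ → ℂ) : Set ℂ := connectedComponentIn (Set.range γ)ᶜ (1 / 2 : ℂ)

/-- For signs `σ, τ ∈ {1, -1}`, a closed sector with apex `0` (apex removed) strictly inside the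
open quadrant `σ Re z > 0`, `τ Im z > 0`. -/
def quadrantSector (σ τ ε : ℝ) : Set ℂ :=
  {z | 0 < τ * z.im ∧ ε * (τ * z.im) ≤ σ * z.re ∧ ε * (σ * z.re) ≤ τ * z.im}

/-- A simple unbounded contour, oriented upwards, that tends to infinity in sectors strictly inside
the left (`σ = -1`) or right (`σ = 1`) half plane. The parameter is Lipschitz and comparable to
the modulus at infinity (as arc length is for a curve asymptotic to rays). -/
structure IsUpwardContour (σ : ℝ) (γ : ℝ → ℂ) : Prop where
  injective : Function.Injective γ
  lipschitz : ∃ C, LipschitzWith C γ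
  linear_growth : ∃ c : ℝ, 0 < c ∧ ∀ᶠ t in cocompact ℝ, c * |t| ≤ ‖γ t‖
  upper_end : ∃ ε : ℝ, 0 < ε ∧ ∀ᶠ t in atTop, γ t ∈ quadrantSector σ 1 ε
  lower_end : ∃ ε : ℝ, 0 < ε ∧ ∀ᶠ t in atBot, γ t ∈ quadrantSector σ (-1) ε

/-- The contours `γ` and `γ̃` (here `γt`) for the function `F`: the line `Re z = 1/2` lies between
them, `γ` lies to the right of the poles of `F`, and `γ̃` to the left of the zeros of `F`. -/
structure AdmissibleContours (F : ℂ → ℂ) (γ γt : ℝ → ℂ) : Prop where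
  left_contour : IsUpwardContour (-1) γ
  right_contour : IsUpwardContour 1 γt
  re_lt : ∀ t, (γ t).re < 1 / 2
  lt_re : ∀ t, 1 / 2 < (γt t).re
  poles : ∀ p, IsPoleOf F p → p ∉ Set.range γ ∧ p ∉ sideOfHalf γ
  zeros : ∀ p, IsZeroOf F p → p ∉ Set.range γt ∧ p ∉ sideOfHalf γt

/-- `∫_γ f(z) dz`. -/
noncomputable def contourIntegral (γ : ℝ → ℂ) (f : ℂ → ℂ) : ℂ :=
  ∫ t : ℝ, f (γ t) * deriv γ t

/-- Absolute convergence of `∫_γ f(z) dz`. -/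
def ContourIntegrable (γ : ℝ → ℂ) (f : ℂ → ℂ) : Prop :=
  Integrable (fun t : ℝ => f (γ t) * deriv γ t)

/-- Absolute convergence of `∫_γ du ∫_γ̃ dv f(u, v)`. -/
def DoubleContourIntegrable (γ γt : ℝ → ℂ) (f : ℂ → ℂ → ℂ) : Prop :=
  Integrable (fun p : ℝ × ℝ => f (γ p.1) (γt p.2) * deriv γt p.2 * deriv γ p.1)

/-- The integrand of the limiting kernel. -/
noncomputable def limitIntegrand (F : ℂ → ℂ) (x y : ℝ) (u v : ℂ) : ℂ :=
  F u / F v * ((x : ℂ) ^ (-u) * (y : ℂ) ^ (v - 1) / (u - v))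

/-- The limiting kernel `𝕂(x, y)`. -/
noncomputable def limitKernel (F : ℂ → ℂ) (γ γt : ℝ → ℂ) (x y : ℝ) : ℂ :=
  1 / (4 * (Real.pi : ℂ) ^ 2) *
    contourIntegral γ fun u => contourIntegral γt fun v => limitIntegrand F x y u v

/-- The integrand of the kernel `ℍ_s(v, z)`. -/
noncomputable def mellinIntegrand (F : ℂ → ℂ) (s : ℝ) (v z u : ℂ) : ℂ :=
  (s : ℂ) ^ (z - u) * (F u / (F v * (v - u) * (z - u)))

/-- The kernel `ℍ_s(v, z) = ∫_γ s^{z-u} F(u) / (F(v) (v-u) (z-u)) du / (2πi)`. -/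
noncomputable def mellinKernel (F : ℂ → ℂ) (γ : ℝ → ℂ) (s : ℝ) (v z : ℂ) : ℂ :=
  1 / (2 * (Real.pi : ℂ) * Complex.I) * contourIntegral γ (mellinIntegrand F s v z)

/-- The integral operator `f ↦ (z ↦ ∫_γ H(v, z) f(v) dv / (2πi))` on functions on a contour,
written as the kernel of an integral operator in the real parameter of the contour. -/
noncomputable def contourOperatorKernel (γ : ℝ → ℂ) (H : ℂ → ℂ → ℂ) (t t' : ℝ) : ℂ :=
  H (γ t) (γ t') * (deriv γ t / (2 * (Real.pi : ℂ) * Complex.I))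

/-- The `m × m` minor `det (K(x_i, x_l))`. -/
noncomputable def kernelMinor {X : Type*} (K : X → X → ℂ) (m : ℕ) (x : Fin m → X) : ℂ :=
  (Matrix.of fun i l : Fin m => K (x i) (x l)).det

/-- The `m`-th term `((-1)^m / m!) ∫ det (K(x_i, x_l)) dμ(x_1) … dμ(x_m)` of the Fredholm series
(equal to `1` for `m = 0`). -/
noncomputable def fredholmTerm {X : Type*} [MeasurableSpace X] (μ : Measure X)
    (K : X → X → ℂ) (m : ℕ) : ℂ :=
  (-1) ^ m / (m.factorial : ℂ) * ∫ x : Fin m → X, kernelMinor K m x ∂(Measure.pi fun _ => μ)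

/-- All the integrals in the Fredholm series, and the series itself, converge absolutely. -/
def FredholmConverges {X : Type*} [MeasurableSpace X] (μ : Measure X) (K : X → X → ℂ) : Prop :=
  (∀ m : ℕ, Integrable (kernelMinor K m) (Measure.pi fun _ : Fin m => μ)) ∧
    Summable (fredholmTerm μ K)

/-- The Fredholm determinant `det(1 - K)` of the integral operator with kernel `K` with respect to
the measure `μ`. -/
noncomputable def fredholmDet {X : Type*} [MeasurableSpace X] (μ : Measure X)
    (K : X → X → ℂ) : ℂ :=
  ∑' m : ℕ, fredholmTerm μ K m

/-! The two determinants are `det(1 - AB)` and `det(1 - BA)` for one factorization. Put `B(v, y) =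
y^(v-1)` and let `A(x, v)` be the rest of the double integral: `1 / F(v)` times the `u`-integral of
`F(u) x^(-u) / (v - u)`, with both factors `1/(2πi)` and the derivative of the parametrization of
`γt`. Integrating `AB` over `v` gives `𝕂` (`limitKernel_eq`). Integrating over `x ∈ (0, s]` gives
`ℍ_s`, because `∫₀ˢ x^(z-u-1) dx = s^(z-u)/(z-u)` when `Re u < Re z`
(`contourOperatorKernel_mellinKernel_eq`).

The Fredholm series then agree term by term (`fredholm_comp_comm`). By Andréief's identity the
`m`-th minors of both kernels are partial integrals of one function of `(x, t)`, and Fubini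
exchanges them. Convergence rests on bounds that separate the variables, `|A| ≤ p(x) g(t)` and `|B|
≤ q(x) h(t)` with `pq` and `gh` integrable; Hadamard's inequality makes the series summable.

These bounds need two facts. A gap `Re u ≤ 1/2 - δ` on `γ` makes `pq = x^(δ-1)` integrable at `0`.
Moreover `F` on `γ` and `1/F` on `γt` decay faster than every exponential
(`HardEdgeModel.exists_norm_F_le`): `1/Γ` decays superexponentially in sectors of the right half
plane, `Γ` is bounded in sectors of the left one, and the conditions on poles and zeros exclude
singularities on the curves. -/

/-! ### Growth of `Γ` and `1 / Γ` in sectors -/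

theorem Complex.norm_Gamma_le_Gamma_re {w : ℂ} (hw : 0 < w.re) :
    ‖Complex.Gamma w‖ ≤ Real.Gamma w.re := by
  rw [Complex.Gamma_eq_integral hw, Real.Gamma_eq_integral hw, Complex.GammaIntegral]
  refine (norm_integral_le_integral_norm _).trans (le_of_eq ?_)
  refine setIntegral_congr_fun measurableSet_Ioi fun x hx => ?_
  have hx' : (0 : ℝ) < x := hx
  simp only [norm_mul, Complex.norm_real, Real.norm_eq_abs, abs_of_pos (Real.exp_pos _),
    Complex.norm_cpow_eq_rpow_re_of_pos hx', Complex.sub_re, Complex.one_re]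

theorem Complex.norm_sin_le_exp_abs_im (z : ℂ) : ‖Complex.sin z‖ ≤ Real.exp |z.im| := by
  have h1 : ‖Complex.exp (-z * I)‖ ≤ Real.exp |z.im| := by
    rw [Complex.norm_exp]
    simpa using Real.exp_le_exp.2 (le_abs_self z.im)
  have h2 : ‖Complex.exp (z * I)‖ ≤ Real.exp |z.im| := by
    rw [Complex.norm_exp]
    simpa using Real.exp_le_exp.2 (neg_le_abs z.im)
  rw [Complex.sin, norm_div, norm_mul, Complex.norm_I, mul_one, Complex.norm_ofNat]
  have := norm_sub_le (Complex.exp (-z * I)) (Complex.exp (z * I))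
  linarith

theorem Complex.abs_im_le_norm_sin (z : ℂ) : |z.im| ≤ ‖Complex.sin z‖ := by
  have h1 : ‖Complex.exp (-z * I)‖ = Real.exp z.im := by
    rw [Complex.norm_exp]; simp
  have h2 : ‖Complex.exp (z * I)‖ = Real.exp (-z.im) := by
    rw [Complex.norm_exp]; simp
  have h3 := abs_norm_sub_norm_le (Complex.exp (-z * I)) (Complex.exp (z * I))
  rw [h1, h2] at h3
  have h4 : |z.im| ≤ |Real.sinh z.im| := by
    rw [Real.abs_sinh]; exact Real.self_le_sinh_iff.2 (abs_nonneg _)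
  rw [Real.sinh_eq, abs_div, abs_two] at h4
  rw [Complex.sin, norm_div, norm_mul, Complex.norm_I, mul_one, Complex.norm_ofNat]
  linarith

/-- Reflection gives `1/Γ(w) = Γ(1-w) sin(πw)/π`. Here `|Γ(1-w)| ≤ 1`, since `|Γ(2-w)| ≤ Γ(2 - Re w)
≤ 1` by convexity between `Γ(1) = Γ(2) = 1`, and `|1-w| ≥ 1`. -/
theorem Complex.norm_inv_Gamma_le_of_re_mem_Ico {w : ℂ} (h0 : 0 ≤ w.re) (h1 : w.re < 1)
    (him : 1 ≤ |w.im|) : ‖(Complex.Gamma w)⁻¹‖ ≤ Real.exp (Real.pi * |w.im|) := by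
  have hne : 1 - w ≠ 0 := by
    intro h
    have : w.im = 0 := by have := congrArg Complex.im h; simpa using this
    rw [this] at him; norm_num at him
  have hG : ‖Complex.Gamma (1 - w)‖ ≤ 1 := by
    have h2 : Complex.Gamma (1 - w + 1) = (1 - w) * Complex.Gamma (1 - w) :=
      Complex.Gamma_add_one _ hne
    have h3 : ‖Complex.Gamma (1 - w + 1)‖ ≤ 1 := by
      refine (Complex.norm_Gamma_le_Gamma_re (by simp; linarith)).trans ?_
      have := Real.convexOn_Gamma.2 (show (1 : ℝ) ∈ Set.Ioi 0 by simp)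
        (show (2 : ℝ) ∈ Set.Ioi 0 by simp) h0 (by linarith : 0 ≤ 1 - w.re) (by ring)
      rw [Real.Gamma_one, Real.Gamma_two] at this
      simp only [smul_eq_mul] at this
      have he : (1 - w + 1).re = w.re * 1 + (1 - w.re) * 2 := by simp; ring
      rw [he]; linarith
    have h4 : 1 ≤ ‖1 - w‖ := by
      have := Complex.abs_im_le_norm (1 - w)
      simp at this; linarith
    rw [h2, norm_mul] at h3
    nlinarith [norm_nonneg (Complex.Gamma (1 - w))]
  have hne' : Complex.Gamma w ≠ 0 := by
    intro h
    obtain ⟨m, hm⟩ := (Complex.Gamma_eq_zero_iff w).1 h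
    rw [hm] at him; norm_num at him
  have hs := Complex.norm_sin_le_exp_abs_im (Real.pi * w)
  have hsim : |((Real.pi : ℂ) * w).im| = Real.pi * |w.im| := by
    simp [abs_mul, abs_of_pos Real.pi_pos]
  rw [hsim] at hs
  have hs0 : Complex.sin (Real.pi * w) ≠ 0 := by
    intro h
    have := Complex.abs_im_le_norm_sin (Real.pi * w)
    rw [h, hsim, norm_zero] at this
    nlinarith [Real.pi_pos]
  have hpi : (Real.pi : ℂ) ≠ 0 := by exact_mod_cast Real.pi_ne_zero
  have hrefl : (Complex.Gamma w)⁻¹ =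
      Complex.Gamma (1 - w) * Complex.sin (Real.pi * w) / Real.pi := by
    have := Complex.Gamma_mul_Gamma_one_sub w
    rw [eq_div_iff hs0] at this
    rw [eq_div_iff hpi, inv_mul_eq_iff_eq_mul₀ hne', ← mul_assoc, this]
  rw [hrefl, norm_div, norm_mul, Complex.norm_real, Real.norm_eq_abs, abs_of_pos Real.pi_pos]
  rw [div_le_iff₀ Real.pi_pos]
  have := Real.pi_gt_three
  have := mul_le_mul hG hs (norm_nonneg _) zero_le_one
  nlinarith [Real.exp_pos (Real.pi * |w.im|)]

/-- Each step of the functional equation divides by `|w + n| ≥ max(n, 1)`, so a factorial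
accumulates. The truncated `n - 1` reflects that the step from `0` to `1` gains only the factor `1`,
from `|w| ≥ |Im w| ≥ 1`. -/
theorem Complex.norm_inv_Gamma_add_nat_le {w : ℂ} (h0 : 0 ≤ w.re) (h1 : w.re < 1)
    (him : 1 ≤ |w.im|) (n : ℕ) :
    ‖(Complex.Gamma (w + n))⁻¹‖ * (n - 1).factorial ≤ Real.exp (Real.pi * |w.im|) := by
  induction n with
  | zero => simpa using Complex.norm_inv_Gamma_le_of_re_mem_Ico h0 h1 him
  | succ n ih =>
    have hne : w + n ≠ 0 := by
      intro h
      have := congrArg Complex.im h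
      simp at this; rw [this] at him; norm_num at him
    have hnorm : (n : ℝ) ≤ ‖w + n‖ := by
      have := Complex.re_le_norm (w + n)
      simp at this; linarith
    have hnorm1 : 1 ≤ ‖w + n‖ := by
      have := Complex.abs_im_le_norm (w + n)
      simp at this; linarith
    have hg : Complex.Gamma (w + (n + 1 : ℕ)) = (w + n) * Complex.Gamma (w + n) := by
      rw [← Complex.Gamma_add_one _ hne]; push_cast; ring_nf
    have hfac : ((n + 1 - 1).factorial : ℝ) ≤ ‖w + n‖ * (n - 1).factorial := by
      rcases n with _ | n
      · simpa using hnorm1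
      · simp only [Nat.add_sub_cancel, Nat.factorial_succ (n), Nat.cast_mul]
        exact mul_le_mul_of_nonneg_right hnorm (by positivity)
    rw [hg, mul_inv, norm_mul, norm_inv]
    refine le_trans ?_ ih
    calc ‖w + n‖⁻¹ * ‖(Complex.Gamma (w + n))⁻¹‖ * ((n + 1 - 1).factorial : ℝ)
        ≤ ‖w + n‖⁻¹ * ‖(Complex.Gamma (w + n))⁻¹‖ * (‖w + n‖ * (n - 1).factorial) := by gcongr
      _ = ‖(Complex.Gamma (w + n))⁻¹‖ * (n - 1).factorial := by
        have : ‖w + n‖ ≠ 0 := by positivity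
        field_simp

/-- Super-exponential decay of `1 / Γ` in sectors of the right half plane. -/
theorem Complex.exists_norm_inv_Gamma_le_exp {ε : ℝ} (hε : 0 < ε) (K : ℝ) :
    ∃ C, ∀ w : ℂ, 1 ≤ |w.im| → ε * |w.im| ≤ w.re →
      ‖(Complex.Gamma w)⁻¹‖ ≤ C * Real.exp (-K * ‖w‖) := by
  -- In the sector, `L * Re w` dominates the loss `π |Im w|` together with `|K| (Re w + |Im w|)`.
  -- The factorial supplies `exp(L Re w)` up to a constant for any `L`, via `(e^L)^k / k! ≤
  -- exp(e^L)`.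
  set L : ℝ := |K| + (Real.pi + |K|) / ε with hL
  refine ⟨Real.exp (Real.exp L) * Real.exp (2 * L), fun w him hre => ?_⟩
  have hL0 : 0 ≤ L := by have := Real.pi_pos; positivity
  have hw0 : 0 ≤ w.re := le_trans (by positivity) hre
  set n := ⌊w.re⌋₊ with hn
  have hn1 : (n : ℝ) ≤ w.re := Nat.floor_le hw0
  have hn2 : w.re < n + 1 := Nat.lt_floor_add_one _
  have key := Complex.norm_inv_Gamma_add_nat_le (w := w - n) (by simpa using hn1)
    (by simp; linarith) (by simpa using him) n
  simp only [sub_add_cancel, Complex.sub_im, Complex.natCast_im, sub_zero] at key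
  have hfac := Real.pow_div_factorial_le_exp (Real.exp L) (Real.exp_pos _).le (n - 1)
  rw [div_le_iff₀ (by positivity), ← Real.exp_nat_mul] at hfac
  have hcast : w.re - 2 ≤ ((n - 1 : ℕ) : ℝ) := by
    rcases hc : n with _ | m
    · rw [hc] at hn2; simp at hn2 ⊢; linarith
    · rw [hc] at hn2; push_cast at hn2; simp; linarith
  have hf2 : Real.exp ((w.re - 2) * L) ≤ Real.exp (Real.exp L) * (n - 1).factorial :=
    (Real.exp_le_exp.2 (mul_le_mul_of_nonneg_right hcast hL0)).trans hfac
  have h3 : ‖(Complex.Gamma w)⁻¹‖ * Real.exp ((w.re - 2) * L) ≤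
      Real.exp (Real.exp L) * Real.exp (Real.pi * |w.im|) := by
    calc _ ≤ ‖(Complex.Gamma w)⁻¹‖ * (Real.exp (Real.exp L) * (n - 1).factorial) := by gcongr
      _ = Real.exp (Real.exp L) * (‖(Complex.Gamma w)⁻¹‖ * (n - 1).factorial) := by ring
      _ ≤ _ := by gcongr
  have hnorm : K * ‖w‖ ≤ |K| * w.re + |K| * |w.im| := by
    have := Complex.norm_le_abs_re_add_abs_im w
    rw [abs_of_nonneg hw0] at this
    calc K * ‖w‖ ≤ |K| * ‖w‖ := mul_le_mul_of_nonneg_right (le_abs_self _) (norm_nonneg _)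
      _ ≤ |K| * (w.re + |w.im|) := mul_le_mul_of_nonneg_left this (abs_nonneg _)
      _ = _ := by ring
  have hLw : (Real.pi + |K|) * |w.im| + |K| * w.re ≤ L * w.re := by
    have : (Real.pi + |K|) * |w.im| = (Real.pi + |K|) / ε * (ε * |w.im|) := by field_simp
    have h5 : (Real.pi + |K|) / ε * (ε * |w.im|) ≤ (Real.pi + |K|) / ε * w.re :=
      mul_le_mul_of_nonneg_left hre (by have := Real.pi_pos; positivity)
    rw [hL, this]; linarith
  rw [← le_div_iff₀ (Real.exp_pos _)] at h3
  refine h3.trans ?_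
  rw [mul_div_assoc, ← Real.exp_sub, ← Real.exp_add, ← Real.exp_add, ← Real.exp_add]
  refine Real.exp_le_exp.2 ?_
  linarith

/-- By reflection `Γ(w) = (π / sin πw) / Γ(1-w)`: the point `1-w` lies in a right sector, where
`1/Γ` is bounded, and `|sin πw| ≥ π |Im w| ≥ π`. -/
theorem Complex.exists_norm_Gamma_le {ε : ℝ} (hε : 0 < ε) :
    ∃ C, ∀ w : ℂ, 1 ≤ |w.im| → ε * |w.im| ≤ -w.re → ‖Complex.Gamma w‖ ≤ C := by
  obtain ⟨C, hC⟩ := Complex.exists_norm_inv_Gamma_le_exp hε 0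
  refine ⟨C, fun w him hre => ?_⟩
  have h := hC (1 - w) (by simpa using him) (by simp; linarith)
  simp only [neg_zero, zero_mul, Real.exp_zero, mul_one] at h
  have hs := Complex.abs_im_le_norm_sin (Real.pi * w)
  have hsim : |((Real.pi : ℂ) * w).im| = Real.pi * |w.im| := by
    simp [abs_mul, abs_of_pos Real.pi_pos]
  rw [hsim] at hs
  have hne' : Complex.Gamma (1 - w) ≠ 0 := Complex.Gamma_ne_zero_of_re_pos (by
    simp; have : 0 ≤ ε * |w.im| := by positivity
    linarith)
  have hrefl : Complex.Gamma w =
      Real.pi / Complex.sin (Real.pi * w) * (Complex.Gamma (1 - w))⁻¹ := by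
    rw [← Complex.Gamma_mul_Gamma_one_sub w]; field_simp
  have hpi := Real.pi_pos
  have hle : ‖(Real.pi : ℂ) / Complex.sin (Real.pi * w)‖ ≤ 1 := by
    rw [norm_div, Complex.norm_real, Real.norm_eq_abs, abs_of_pos hpi]
    exact div_le_one_of_le₀ (by nlinarith) (norm_nonneg _)
  rw [hrefl, norm_mul]
  exact (mul_le_of_le_one_left (norm_nonneg _) hle).trans h

/-! ### Determinant bounds, Andréief's identity and Fredholm series -/

open scoped ComplexOrder in
/-- A form of the Hadamard determinant inequality. -/
theorem Matrix.norm_det_sq_le {m : ℕ} (M : Matrix (Fin m) (Fin m) ℂ) {C : ℝ}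
    (hM : ∀ i l, ‖M i l‖ ≤ C) : ‖M.det‖ ^ 2 ≤ (m * C ^ 2) ^ m := by
  rcases Nat.eq_zero_or_pos m with rfl | hm
  · simp
  have hm' : (0 : ℝ) < m := by exact_mod_cast hm
  -- The eigenvalues of `M Mᴴ` have product `|det M|²` and sum `∑ |M i l|² ≤ m² C²`; the inequality
  -- of arithmetic and geometric means concludes.
  have hP := Matrix.posSemidef_self_mul_conjTranspose M
  have hdet : ‖M.det‖ ^ 2 = ∏ i, hP.1.eigenvalues i := by
    have h := hP.1.det_eq_prod_eigenvalues
    rw [Matrix.det_mul, Matrix.det_conjTranspose] at h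
    have h2 : M.det * star M.det = ((‖M.det‖ ^ 2 : ℝ) : ℂ) := by
      rw [Complex.star_def, Complex.mul_conj, Complex.normSq_eq_norm_sq]
    rw [h2] at h
    exact Complex.ofReal_injective (h.trans (by push_cast; rfl))
  have htr : ∑ i, hP.1.eigenvalues i ≤ m * (m * C ^ 2) := by
    have h := hP.1.trace_eq_sum_eigenvalues
    have h2 : (M * M.conjTranspose).trace = ((∑ i, ∑ l, ‖M i l‖ ^ 2 : ℝ) : ℂ) := by
      simp only [Matrix.trace, Matrix.diag_apply, Matrix.mul_apply, Matrix.conjTranspose_apply,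
        Complex.star_def, Complex.mul_conj, Complex.normSq_eq_norm_sq]
      push_cast; rfl
    rw [h2] at h
    have h3 : ∑ i, hP.1.eigenvalues i = ∑ i, ∑ l, ‖M i l‖ ^ 2 :=
      Complex.ofReal_injective (Eq.trans (by push_cast; rfl) h.symm)
    rw [h3]
    calc ∑ i, ∑ l, ‖M i l‖ ^ 2 ≤ ∑ _i : Fin m, ∑ _l : Fin m, C ^ 2 := by
          gcongr with i _ l _; exact hM i l
      _ = _ := by simp
  have hamgm := Real.geom_mean_le_arith_mean Finset.univ (fun _ : Fin m => (1 : ℝ))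
    hP.1.eigenvalues (fun _ _ => zero_le_one) (by simpa using hm) (fun i _ => hP.eigenvalues_nonneg i)
  simp only [Real.rpow_one, one_mul, Finset.sum_const, Finset.card_univ, Fintype.card_fin,
    nsmul_eq_mul, mul_one] at hamgm
  have hprod0 : 0 ≤ ∏ i, hP.1.eigenvalues i :=
    Finset.prod_nonneg fun i _ => hP.eigenvalues_nonneg i
  rw [hdet]
  have h4 : (∏ i, hP.1.eigenvalues i) ^ ((m : ℝ)⁻¹) ≤ m * C ^ 2 := by
    refine hamgm.trans ?_
    rw [div_le_iff₀ hm']; linarith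
  calc ∏ i, hP.1.eigenvalues i = ((∏ i, hP.1.eigenvalues i) ^ ((m : ℝ)⁻¹)) ^ m := by
        rw [← Real.rpow_natCast, ← Real.rpow_mul hprod0, inv_mul_cancel₀ hm'.ne', Real.rpow_one]
    _ ≤ _ := pow_le_pow_left₀ (Real.rpow_nonneg hprod0 _) h4 m

/-- Dividing row `i` by `p i` and column `l` by `q l` reduces to entries bounded by `C`. -/
theorem Matrix.norm_det_le_of_norm_le_mul {m : ℕ} (M : Matrix (Fin m) (Fin m) ℂ) {C : ℝ}
    (hC : 0 ≤ C) {p q : Fin m → ℝ} (hp : ∀ i, 0 < p i) (hq : ∀ i, 0 < q i)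
    (hM : ∀ i l, ‖M i l‖ ≤ C * (p i * q l)) :
    ‖M.det‖ ≤ (√m * C) ^ m * ∏ i, p i * q i := by
  set N : Matrix (Fin m) (Fin m) ℂ := Matrix.of fun i l => M i l / ((p i : ℂ) * q l) with hN
  have hMN : M = Matrix.of fun i l => (p i : ℂ) * (Matrix.of fun i l => (q l : ℂ) * N i l) i l := by
    ext i l
    have h1 : (p i : ℂ) ≠ 0 := by exact_mod_cast (hp i).ne'
    have h2 : (q l : ℂ) ≠ 0 := by exact_mod_cast (hq l).ne'
    simp only [Matrix.of_apply, hN]; field_simp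
  have hNb : ∀ i l, ‖N i l‖ ≤ C := by
    intro i l
    have := mul_pos (hp i) (hq l)
    simp only [hN, Matrix.of_apply, norm_div, norm_mul, Complex.norm_real, Real.norm_eq_abs,
      abs_of_pos (hp i), abs_of_pos (hq l)]
    rw [div_le_iff₀ this]; exact hM i l
  have hdN : ‖N.det‖ ≤ (√m * C) ^ m := by
    have h := Matrix.norm_det_sq_le N hNb
    refine abs_le_of_sq_le_sq' ?_ (by positivity) |>.2
    calc ‖N.det‖ ^ 2 ≤ (m * C ^ 2) ^ m := h
      _ = ((√m * C) ^ m) ^ 2 := by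
        rw [← pow_mul, mul_comm m 2, pow_mul, mul_pow √_, Real.sq_sqrt (Nat.cast_nonneg _)]
  rw [hMN, Matrix.det_mul_column, Matrix.det_mul_row, norm_mul, norm_mul, norm_prod, norm_prod,
    Finset.prod_mul_distrib]
  simp only [Complex.norm_real, Real.norm_eq_abs, abs_of_pos (hp _), abs_of_pos (hq _)]
  have : 0 ≤ ∏ i, p i := Finset.prod_nonneg fun i _ => (hp i).le
  have : 0 ≤ ∏ i, q i := Finset.prod_nonneg fun i _ => (hq i).le
  calc (∏ i, p i) * ((∏ i, q i) * ‖N.det‖) ≤ (∏ i, p i) * ((∏ i, q i) * (√m * C) ^ m) := by gcongr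
    _ = _ := by ring

/-- The square of the term is `(m^m / m!) (C²)^m / m!`. Since `m^m / m! ≤ e^m` and `(4 C² e)^m / m!`
is bounded, it is at most a constant times `4^(-m)`, so the term is dominated by a geometric series
of ratio `1/2`. -/
theorem summable_sqrt_mul_pow_div_factorial {C : ℝ} (hC : 0 ≤ C) :
    Summable fun m : ℕ => (√m * C) ^ m / (m.factorial : ℝ) := by
  refine Summable.of_nonneg_of_le (fun m => by positivity) (fun m => ?_)
    ((summable_geometric_two).mul_left (Real.exp (2 * C ^ 2 * Real.exp 1)))
  have h1 := Real.pow_div_factorial_le_exp m (Nat.cast_nonneg m) m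
  have hC2 : 0 ≤ 4 * C ^ 2 * Real.exp 1 := by positivity
  have h2 := Real.pow_div_factorial_le_exp (4 * C ^ 2 * Real.exp 1) hC2 m
  refine abs_le_of_sq_le_sq' ?_ (by positivity) |>.2
  have hexp : Real.exp (m : ℝ) = Real.exp 1 ^ m := by rw [← Real.exp_nat_mul, mul_one]
  have hf : (0 : ℝ) < m.factorial := by positivity
  rw [hexp] at h1
  calc ((√m * C) ^ m / (m.factorial : ℝ)) ^ 2
      = ((m : ℝ) ^ m / m.factorial) * ((C ^ 2) ^ m / m.factorial) := by
        rw [div_pow, ← pow_mul, mul_comm m 2, pow_mul, mul_pow √_,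
          Real.sq_sqrt (Nat.cast_nonneg _), mul_pow]
        field_simp
    _ ≤ Real.exp 1 ^ m * ((C ^ 2) ^ m / m.factorial) := by gcongr
    _ = ((4 * C ^ 2 * Real.exp 1) ^ m / m.factorial) * (1 / 4) ^ m := by
        rw [mul_pow, mul_pow, div_pow]; field_simp; simp
    _ ≤ Real.exp (4 * C ^ 2 * Real.exp 1) * (1 / 4) ^ m := by gcongr
    _ = (Real.exp (2 * C ^ 2 * Real.exp 1) * (1 / 2) ^ m) ^ 2 := by
        rw [mul_pow, ← Real.exp_nat_mul, ← pow_mul, mul_comm m 2, pow_mul]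
        norm_num; ring

/-- The Andréief identity, with the left functions left unsymmetrized. -/
theorem det_integral_mul_eq_integral {T : Type*} [MeasurableSpace T] (ν : Measure T) [SigmaFinite ν]
    {m : ℕ} (a b : Fin m → T → ℂ) (hab : ∀ i l, Integrable (fun t => a i t * b l t) ν) :
    (Matrix.of fun i l => ∫ t, a i t * b l t ∂ν).det =
      ∫ t : Fin m → T, (∏ i, a i (t i)) * (Matrix.of fun i l => b l (t i)).det
        ∂(Measure.pi fun _ => ν) := by
  have hdet : ∀ M : Matrix (Fin m) (Fin m) ℂ,
      M.det = ∑ σ : Equiv.Perm (Fin m), ((Equiv.Perm.sign σ : ℤ) : ℂ) * ∏ i, M i (σ i) := by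
    intro M
    rw [← Matrix.det_transpose, Matrix.det_apply']; rfl
  simp only [hdet, Matrix.of_apply, Finset.mul_sum]
  rw [integral_finsetSum]
  · refine Finset.sum_congr rfl fun σ _ => ?_
    rw [← integral_fintype_prod_eq_prod (fun i t => a i t * b (σ i) t), ← integral_const_mul]
    refine integral_congr_ae (Eventually.of_forall fun t => ?_)
    simp only [Finset.prod_mul_distrib]; ring
  · intro σ _
    have h := (Integrable.fintype_prod (μ := fun _ : Fin m => ν)
      (f := fun i t => a i t * b (σ i) t) fun i => hab i (σ i)).const_mul
        ((Equiv.Perm.sign σ : ℤ) : ℂ)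
    refine h.congr (Eventually.of_forall fun t => ?_)
    simp only [Finset.prod_mul_distrib]; ring

/-- A crude Leibniz bound, enough for Fubini at fixed `m`; Hadamard's bound is needed only when
summing over `m`. -/
theorem Matrix.norm_det_le_factorial_mul_prod {m : ℕ} (M : Matrix (Fin m) (Fin m) ℂ)
    {h q : Fin m → ℝ} (hM : ∀ i l, ‖M i l‖ ≤ q l * h i) :
    ‖M.det‖ ≤ m.factorial * ((∏ i, q i) * ∏ i, h i) := by
  rw [Matrix.det_apply]
  refine (norm_sum_le _ _).trans ?_
  calc ∑ σ : Equiv.Perm (Fin m), ‖Equiv.Perm.sign σ • ∏ i, M (σ i) i‖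
      ≤ ∑ _σ : Equiv.Perm (Fin m), (∏ i, q i) * ∏ i, h i := by
        refine Finset.sum_le_sum fun σ _ => ?_
        rw [← Equiv.prod_comp σ h, ← Finset.prod_mul_distrib]
        have : ‖Equiv.Perm.sign σ • ∏ i, M (σ i) i‖ = ∏ i, ‖M (σ i) i‖ := by
          rw [← norm_prod]
          rcases Int.units_eq_one_or (Equiv.Perm.sign σ) with h | h <;> simp [h]
        rw [this]
        exact Finset.prod_le_prod (fun _ _ => norm_nonneg _) fun i _ => hM _ _
    _ = _ := by simp [Fintype.card_perm]

/-- `det(1 - AB) = det(1 - BA)` for integral operators with kernels of rank-one growth. -/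
theorem fredholm_comp_comm {X T : Type*} [MeasurableSpace X] [MeasurableSpace T]
    (μ : Measure X) (ν : Measure T) [SigmaFinite μ] [SigmaFinite ν]
    (A : X → T → ℂ) (B : T → X → ℂ) (K : X → X → ℂ) (H : T → T → ℂ)
    (hA : Measurable (Function.uncurry A)) (hB : Measurable (Function.uncurry B))
    {S : Set X} (hS : ∀ᵐ x ∂μ, x ∈ S) {p q : X → ℝ} {g h : T → ℝ}
    (hp : ∀ x ∈ S, 0 < p x) (hq : ∀ x ∈ S, 0 < q x)
    (hAb : ∀ x ∈ S, ∀ t, ‖A x t‖ ≤ p x * g t) (hBb : ∀ t, ∀ x ∈ S, ‖B t x‖ ≤ q x * h t)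
    (hpq : Integrable (fun x => p x * q x) μ) (hgh : Integrable (fun t => g t * h t) ν)
    (hK : ∀ x ∈ S, ∀ y ∈ S, K x y = ∫ t, A x t * B t y ∂ν)
    (hH : ∀ t t', H t t' = ∫ x, A x t * B t' x ∂μ) :
    FredholmConverges μ K ∧ FredholmConverges ν H ∧ fredholmDet μ K = fredholmDet ν H := by
  have hAx : ∀ x, Measurable (A x) := fun x => hA.comp (measurable_const.prodMk measurable_id)
  have hAt : ∀ t, Measurable fun x => A x t := fun t =>
    hA.comp (measurable_id.prodMk measurable_const)
  have hBt : ∀ t, Measurable (B t) := fun x => hB.comp (measurable_const.prodMk measurable_id)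
  have hBx : ∀ x, Measurable fun t => B t x := fun t =>
    hB.comp (measurable_id.prodMk measurable_const)
  have hABb : ∀ x ∈ S, ∀ y ∈ S, ∀ t t', ‖A x t * B t' y‖ ≤ (p x * q y) * (g t * h t') := by
    intro x hx y hy t t'
    rw [norm_mul]
    calc _ ≤ (p x * g t) * (q y * h t') :=
          mul_le_mul (hAb x hx t) (hBb t' y hy) (norm_nonneg _) ((norm_nonneg _).trans (hAb x hx t))
      _ = _ := by ring
  have hIx : ∀ t t', Integrable (fun x => A x t * B t' x) μ := by
    intro t t'
    refine (hpq.mul_const (g t * h t')).mono' ((hAt t).mul (hBt t')).aestronglyMeasurable ?_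
    filter_upwards [hS] with x hx using hABb x hx x hx t t'
  have hIt : ∀ x ∈ S, ∀ y ∈ S, Integrable (fun t => A x t * B t y) ν := by
    intro x hx y hy
    exact (hgh.const_mul (p x * q y)).mono' ((hAx x).mul (hBx y)).aestronglyMeasurable
      (Eventually.of_forall fun t => hABb x hx y hy t t)
  have hSpi : ∀ m : ℕ, ∀ᵐ x ∂(Measure.pi fun _ : Fin m => μ), ∀ i, x i ∈ S := fun m =>
    eventually_all.2 fun i => Measure.tendsto_eval_ae_ae.eventually hS
  -- The common function: its `t`-integral is the minor of `K`, its `x`-integral the minor of `H`.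
  let W : (m : ℕ) → (Fin m → X) → (Fin m → T) → ℂ := fun m x t =>
    (∏ i, A (x i) (t i)) * (Matrix.of fun i l => B (t i) (x l)).det
  have hKm : ∀ m, ∀ x : Fin m → X, (∀ i, x i ∈ S) →
      kernelMinor K m x = ∫ t, W m x t ∂(Measure.pi fun _ => ν) := by
    intro m x hx
    rw [← det_integral_mul_eq_integral ν (fun i t => A (x i) t) (fun l t => B t (x l))
      fun i l => hIt _ (hx i) _ (hx l)]
    simp only [kernelMinor]
    congr 2
    ext i l
    exact hK _ (hx i) _ (hx l)
  have hHm : ∀ m, ∀ t : Fin m → T,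
      kernelMinor H m t = ∫ x, W m x t ∂(Measure.pi fun _ => μ) := by
    intro m t
    have := det_integral_mul_eq_integral μ (fun i x => A x (t i)) (fun l x => B (t l) x)
      fun i l => hIx _ _
    simp only [kernelMinor, hH]
    rw [this]
    refine integral_congr_ae (Eventually.of_forall fun x => ?_)
    simp only [W]
    -- `H t t'` is the transpose of the kernel of `BA`, which leaves its minors unchanged.
    rw [← Matrix.det_transpose]
    rfl
  have hWint : ∀ m, Integrable (fun z : (Fin m → X) × (Fin m → T) => W m z.1 z.2)
      ((Measure.pi fun _ => μ).prod (Measure.pi fun _ => ν)) := by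
    intro m
    have h1 := Integrable.fintype_prod (μ := fun _ : Fin m => μ) (f := fun _ x => p x * q x)
      fun _ => hpq
    have h2 := Integrable.fintype_prod (μ := fun _ : Fin m => ν) (f := fun _ t => g t * h t)
      fun _ => hgh
    refine ((h1.mul_prod h2).const_mul (m.factorial : ℝ)).mono' ?_ ?_
    · refine Measurable.aestronglyMeasurable (Measurable.mul ?_ ?_)
      · refine Finset.measurable_prod _ fun i _ => ?_
        exact hA.comp (f := fun z : (Fin m → X) × (Fin m → T) => (z.1 i, z.2 i)) (by fun_prop)
      · simp only [Matrix.det_apply']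
        refine Finset.measurable_sum _ fun σ _ => measurable_const.mul ?_
        refine Finset.measurable_prod _ fun i _ => ?_
        exact hB.comp (f := fun z : (Fin m → X) × (Fin m → T) => (z.2 (σ i), z.1 i)) (by fun_prop)
    · have hS2 : ∀ᵐ z ∂((Measure.pi fun _ : Fin m => μ).prod (Measure.pi fun _ : Fin m => ν)),
          ∀ i, z.1 i ∈ S := Measure.quasiMeasurePreserving_fst.ae (hSpi m)
      filter_upwards [hS2] with z hz
      have hd := Matrix.norm_det_le_factorial_mul_prod
        (Matrix.of fun i l => B (z.2 i) (z.1 l)) (h := fun i => h (z.2 i)) (q := fun l => q (z.1 l))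
        fun i l => hBb _ _ (hz l)
      have ha : ‖∏ i, A (z.1 i) (z.2 i)‖ ≤ (∏ i, p (z.1 i)) * ∏ i, g (z.2 i) := by
        rw [norm_prod, ← Finset.prod_mul_distrib]
        exact Finset.prod_le_prod (fun _ _ => norm_nonneg _) fun i _ => hAb _ (hz i) _
      simp only [W, norm_mul, Finset.prod_mul_distrib]
      calc _ ≤ ((∏ i, p (z.1 i)) * ∏ i, g (z.2 i)) *
            (m.factorial * ((∏ i, q (z.1 i)) * ∏ i, h (z.2 i))) :=
            mul_le_mul ha hd (norm_nonneg _) ((norm_nonneg _).trans ha)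
        _ = _ := by ring
  have hKint : ∀ m, Integrable (kernelMinor K m) (Measure.pi fun _ : Fin m => μ) := fun m =>
    (hWint m).integral_prod_left.congr <| by
      filter_upwards [hSpi m] with x hx using (hKm m x hx).symm
  have hHint : ∀ m, Integrable (kernelMinor H m) (Measure.pi fun _ : Fin m => ν) := fun m =>
    (hWint m).integral_prod_right.congr (Eventually.of_forall fun t => (hHm m t).symm)
  have hterm : fredholmTerm μ K = fredholmTerm ν H := by
    ext m
    simp only [fredholmTerm]
    congr 1
    calc _ = ∫ x, ∫ t, W m x t ∂(Measure.pi fun _ => ν) ∂(Measure.pi fun _ => μ) :=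
          integral_congr_ae (by filter_upwards [hSpi m] with x hx using hKm m x hx)
      _ = ∫ t, ∫ x, W m x t ∂(Measure.pi fun _ => μ) ∂(Measure.pi fun _ => ν) :=
          integral_integral_swap (hWint m)
      _ = _ := by simp only [hHm]
  have hsum : Summable (fredholmTerm μ K) := by
    set D : ℝ := |∫ t, g t * h t ∂ν| with hD
    set E : ℝ := |∫ x, p x * q x ∂μ| with hE
    -- The `t`-integral is absorbed in `D`, so `K` itself has a rank-one bound, to which Hadamard's
    -- inequality applies.
    have hKb : ∀ x ∈ S, ∀ y ∈ S, ‖K x y‖ ≤ D * (p x * q y) := by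
      intro x hx y hy
      have hpos := mul_pos (hp x hx) (hq y hy)
      rw [hK x hx y hy]
      calc _ ≤ ∫ t, (p x * q y) * (g t * h t) ∂ν :=
            norm_integral_le_of_norm_le (hgh.const_mul _)
              (Eventually.of_forall fun t => hABb x hx y hy t t)
        _ = (p x * q y) * ∫ t, g t * h t ∂ν := integral_const_mul _ _
        _ ≤ (p x * q y) * D := mul_le_mul_of_nonneg_left (le_abs_self _) hpos.le
        _ = _ := mul_comm _ _
    refine Summable.of_norm_bounded
      (summable_sqrt_mul_pow_div_factorial (C := D * E) (by positivity)) fun m => ?_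
    have h1 := Integrable.fintype_prod (μ := fun _ : Fin m => μ) (f := fun _ x => p x * q x)
      fun _ => hpq
    have hint : ‖∫ x, kernelMinor K m x ∂(Measure.pi fun _ : Fin m => μ)‖ ≤ (√m * D) ^ m * E ^ m := by
      calc _ ≤ ∫ x : Fin m → X, (√m * D) ^ m * ∏ i, p (x i) * q (x i) ∂(Measure.pi fun _ => μ) := by
            refine norm_integral_le_of_norm_le (h1.const_mul _) ?_
            filter_upwards [hSpi m] with x hx
            exact Matrix.norm_det_le_of_norm_le_mul _ (abs_nonneg _) (fun i => hp _ (hx i))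
              (fun i => hq _ (hx i)) fun i l => hKb _ (hx i) _ (hx l)
        _ = (√m * D) ^ m * (∫ x, p x * q x ∂μ) ^ m := by
            rw [integral_const_mul,
              integral_fintype_prod_eq_prod (μ := fun _ : Fin m => μ) (fun _ x => p x * q x)]
            simp
        _ ≤ _ := by
            refine mul_le_mul_of_nonneg_left ?_ (by positivity)
            rw [hE, ← abs_pow]; exact le_abs_self _
    have hf : (0 : ℝ) < m.factorial := by positivity
    rw [fredholmTerm, norm_mul, norm_div, norm_pow, norm_neg, norm_one, one_pow,
      Complex.norm_natCast, one_div, inv_mul_le_iff₀ hf, mul_div_cancel₀ _ hf.ne']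
    refine hint.trans (le_of_eq ?_)
    rw [← mul_pow, mul_assoc]
  exact ⟨⟨hKint, hsum⟩, ⟨hHint, hterm ▸ hsum⟩, by simp only [fredholmDet, hterm]⟩

/-! ### Ends of the contours and Gamma factors along them -/

/-- Both ends of the curve go to infinity in sectors of the half plane `0 < σ Re z`, away from the
real axis. -/
def EndsInSectors (σ : ℝ) (γ : ℝ → ℂ) : Prop :=
  ∃ ε : ℝ, 0 < ε ∧ ∀ N : ℝ, ∀ᶠ t in cocompact ℝ,
    N ≤ |(γ t).im| ∧ ε * |(γ t).im| ≤ σ * (γ t).re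

theorem IsUpwardContour.continuous {σ : ℝ} {γ : ℝ → ℂ} (h : IsUpwardContour σ γ) :
    Continuous γ := h.lipschitz.choose_spec.continuous

theorem IsUpwardContour.tendsto_norm {σ : ℝ} {γ : ℝ → ℂ} (h : IsUpwardContour σ γ) :
    Tendsto (fun t => ‖γ t‖) (cocompact ℝ) atTop := by
  obtain ⟨c, hc, h⟩ := h.linear_growth
  exact tendsto_atTop_mono' _ h ((tendsto_norm_cocompact_atTop (E := ℝ)).const_mul_atTop hc)

/-- The sector also keeps the curve away from the real axis: `|Re|` is at most a multiple of `|Im|`,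
so `|γ| → ∞` forces `|Im γ| → ∞`. -/
theorem IsUpwardContour.endsInSectors {σ : ℝ} {γ : ℝ → ℂ} (h : IsUpwardContour σ γ)
    (hσ : |σ| = 1) : EndsInSectors σ γ := by
  obtain ⟨ε₁, h₁, hup⟩ := h.upper_end
  obtain ⟨ε₂, h₂, hlo⟩ := h.lower_end
  have hε : 0 < min ε₁ ε₂ := lt_min h₁ h₂
  have key : ∀ᶠ t in cocompact ℝ, min ε₁ ε₂ * |(γ t).im| ≤ σ * (γ t).re ∧
      min ε₁ ε₂ * (σ * (γ t).re) ≤ |(γ t).im| := by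
    have aux : ∀ {ε a b : ℝ}, min ε₁ ε₂ ≤ ε → 0 ≤ a → ε * a ≤ b → ε * b ≤ a →
        min ε₁ ε₂ * a ≤ b ∧ min ε₁ ε₂ * b ≤ a := by
      intro ε a b hle ha h1 h2
      have hb : 0 ≤ b := le_trans (mul_nonneg (hε.le.trans hle) ha) h1
      exact ⟨(mul_le_mul_of_nonneg_right hle ha).trans h1,
        (mul_le_mul_of_nonneg_right hle hb).trans h2⟩
    rw [cocompact_eq_atBot_atTop, eventually_sup]
    constructor
    · filter_upwards [hlo] with t ⟨h1, h2, h3⟩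
      have : |(γ t).im| = -1 * (γ t).im := by rw [abs_of_neg (by linarith)]; ring
      rw [this]
      exact aux (min_le_right _ _) h1.le h2 h3
    · filter_upwards [hup] with t ⟨h1, h2, h3⟩
      have : |(γ t).im| = 1 * (γ t).im := by rw [abs_of_pos (by linarith)]; ring
      rw [this]
      exact aux (min_le_left _ _) h1.le h2 h3
  refine ⟨min ε₁ ε₂, hε, fun N => ?_⟩
  filter_upwards [key, h.tendsto_norm.eventually_ge_atTop ((1 / min ε₁ ε₂ + 1) * N)]
    with t ⟨h1, h2⟩ h3
  refine ⟨?_, h1⟩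
  have hre : |(γ t).re| = σ * (γ t).re := by
    rw [← abs_of_nonneg (le_trans (by positivity) h1), abs_mul, hσ, one_mul]
  have h4 := Complex.norm_le_abs_re_add_abs_im (γ t)
  have h5 : |(γ t).re| ≤ 1 / min ε₁ ε₂ * |(γ t).im| := by
    rw [hre, one_div, ← div_eq_inv_mul, le_div_iff₀ hε]; linarith
  have h6 : (1 / min ε₁ ε₂ + 1) * N ≤ (1 / min ε₁ ε₂ + 1) * |(γ t).im| := by linarith
  exact le_of_mul_le_mul_left h6 (by positivity)

theorem EndsInSectors.neg {σ : ℝ} {γ : ℝ → ℂ} (h : EndsInSectors σ γ) :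
    EndsInSectors (-σ) fun t => -γ t := by
  obtain ⟨ε, hε, h⟩ := h
  refine ⟨ε, hε, fun N => ?_⟩
  filter_upwards [h N] with t ht
  simpa using ht

theorem EndsInSectors.affine {σ : ℝ} {γ : ℝ → ℂ} (h : EndsInSectors σ γ) {c : ℝ} (hc : 0 < c)
    (d : ℝ) : EndsInSectors σ fun t => c * γ t + d := by
  obtain ⟨ε, hε, h⟩ := h
  -- Half of the aperture constant absorbs the shift `d` once `|Im γ|` is large.
  refine ⟨ε / 2, by positivity, fun N => ?_⟩
  filter_upwards [h (max (N / c) (2 * |σ * d| / (c * ε)))] with t ⟨h1, h2⟩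
  have h3 := (le_max_left _ _).trans h1
  have h4 := (le_max_right _ _).trans h1
  rw [div_le_iff₀ hc] at h3
  rw [div_le_iff₀ (by positivity)] at h4
  have h5 : -(σ * d) ≤ |σ * d| := neg_le_abs _
  have h6 := mul_le_mul_of_nonneg_left h2 hc.le
  simp only [Complex.add_im, Complex.mul_im, Complex.ofReal_im, Complex.ofReal_re, zero_mul,
    add_zero, abs_mul, abs_of_pos hc, Complex.add_re, Complex.mul_re, sub_zero]
  constructor <;> linarith

theorem EndsInSectors.reflect {σ : ℝ} {γ : ℝ → ℂ} (h : EndsInSectors σ γ) {θ : ℝ} (hθ : 0 < θ)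
    (b : ℝ) : EndsInSectors (-σ) fun t => (b - γ t) / θ := by
  have := h.neg.affine (inv_pos.2 hθ) (b / θ)
  convert this using 2 with t
  push_cast; ring

theorem EndsInSectors.Gamma_isBigO_one {γ : ℝ → ℂ} (h : EndsInSectors (-1) γ) :
    (fun t => Complex.Gamma (γ t)) =O[cocompact ℝ] fun _ => (1 : ℝ) := by
  obtain ⟨ε, hε, h⟩ := h
  obtain ⟨C, hC⟩ := Complex.exists_norm_Gamma_le hε
  refine Asymptotics.IsBigO.of_bound C ?_
  filter_upwards [h 1] with t ht
  simpa using hC _ ht.1 (by linarith [ht.2])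

theorem EndsInSectors.inv_Gamma_isBigO {γ : ℝ → ℂ} (h : EndsInSectors 1 γ) (K : ℝ) :
    (fun t => (Complex.Gamma (γ t))⁻¹) =O[cocompact ℝ] fun t => Real.exp (-K * ‖γ t‖) := by
  obtain ⟨ε, hε, h⟩ := h
  obtain ⟨C, hC⟩ := Complex.exists_norm_inv_Gamma_le_exp hε K
  refine Asymptotics.IsBigO.of_bound C ?_
  filter_upwards [h 1] with t ht
  simpa only [Real.norm_eq_abs, Real.abs_exp] using hC _ ht.1 (by linarith [ht.2])

/-! ### A common form of the three models as a quotient of entire functions -/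

/-- `Γ(z + a) ∏ₖ (ρₖ - z) / ∏ⱼ Γ((bⱼ - z) / θⱼ)`, with a product of reciprocal Gamma functions in
place of the quotient. -/
noncomputable def gammaQuotient {ι κ : Type*} [Fintype ι] [Fintype κ] (a : ℝ) (ρ : κ → ℝ)
    (b θ : ι → ℝ) (z : ℂ) : ℂ :=
  ((Complex.Gamma (z + a))⁻¹)⁻¹ *
    ((∏ k, ((ρ k : ℂ) - z)) * ∏ j, (Complex.Gamma ((b j - z) / θ j))⁻¹)

theorem exp_isBigO_exp_of_norm_le {α : Type*} {l : Filter α} {f g : α → ℂ} {K M D : ℝ}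
    (h : ∀ t, M * ‖g t‖ ≤ K * ‖f t‖ + D) :
    (fun t => Real.exp (-K * ‖f t‖)) =O[l] fun t => Real.exp (-M * ‖g t‖) := by
  refine Asymptotics.IsBigO.of_bound (Real.exp D) (Eventually.of_forall fun t => ?_)
  simp only [Real.norm_eq_abs, Real.abs_exp, ← Real.exp_add]
  refine Real.exp_le_exp.2 ?_
  linarith [h t]

theorem EndsInSectors.inv_Gamma_add_isBigO {γ : ℝ → ℂ} (h : EndsInSectors 1 γ) (a : ℝ) {K : ℝ}
    (hK : 0 ≤ K) :
    (fun t => (Complex.Gamma (γ t + a))⁻¹) =O[cocompact ℝ] fun t => Real.exp (-K * ‖γ t‖) := by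
  have h1 := h.affine one_pos a
  simp only [Complex.ofReal_one, one_mul] at h1
  refine (h1.inv_Gamma_isBigO K).trans (exp_isBigO_exp_of_norm_le (D := K * |a|) fun t => ?_)
  have : ‖γ t‖ ≤ ‖γ t + a‖ + |a| := by
    have := norm_sub_le (γ t + a) (a : ℂ)
    simpa using this
  nlinarith

theorem EndsInSectors.inv_Gamma_reflect_isBigO {γ : ℝ → ℂ} (h : EndsInSectors (-1) γ) {θ : ℝ}
    (hθ : 0 < θ) (b : ℝ) {K : ℝ} (hK : 0 ≤ K) :
    (fun t => (Complex.Gamma ((b - γ t) / θ))⁻¹) =O[cocompact ℝ]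
      fun t => Real.exp (-K * ‖γ t‖) := by
  have h1 := h.reflect hθ b
  rw [neg_neg] at h1
  refine (h1.inv_Gamma_isBigO (K * θ)).trans (exp_isBigO_exp_of_norm_le (D := K * |b|) fun t => ?_)
  have : ‖γ t‖ ≤ θ * ‖((b : ℂ) - γ t) / θ‖ + |b| := by
    have h2 := norm_sub_le (b : ℂ) ((b : ℂ) - γ t)
    rw [norm_div, Complex.norm_real, Real.norm_eq_abs, abs_of_pos hθ, mul_div_cancel₀ _ hθ.ne']
    simp only [sub_sub_cancel, Complex.norm_real, Real.norm_eq_abs] at h2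
    linarith
  calc K * ‖γ t‖ ≤ K * (θ * ‖((b : ℂ) - γ t) / θ‖ + |b|) := mul_le_mul_of_nonneg_left this hK
    _ = _ := by ring

theorem EndsInSectors.Gamma_reflect_isBigO_one {γ : ℝ → ℂ} (h : EndsInSectors 1 γ) {θ : ℝ}
    (hθ : 0 < θ) (b : ℝ) :
    (fun t => Complex.Gamma ((b - γ t) / θ)) =O[cocompact ℝ] fun _ => (1 : ℝ) :=
  (h.reflect hθ b).Gamma_isBigO_one

theorem EndsInSectors.inv_sub_isBigO_one {σ : ℝ} {γ : ℝ → ℂ} (h : EndsInSectors σ γ) (r : ℝ) :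
    (fun t => ((r : ℂ) - γ t)⁻¹) =O[cocompact ℝ] fun _ => (1 : ℝ) := by
  obtain ⟨ε, hε, h⟩ := h
  refine Asymptotics.IsBigO.of_bound 1 ?_
  filter_upwards [h 1] with t ht
  have := Complex.abs_im_le_norm ((r : ℂ) - γ t)
  simp only [Complex.sub_im, Complex.ofReal_im, zero_sub, abs_neg] at this
  rw [norm_inv, norm_one, mul_one]
  exact inv_le_one_of_one_le₀ (ht.1.trans this)

theorem sub_isBigO_exp_norm (γ : ℝ → ℂ) (r : ℝ) :
    (fun t => (r : ℂ) - γ t) =O[cocompact ℝ] fun t => Real.exp ‖γ t‖ := by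
  refine Asymptotics.IsBigO.of_bound (|r| + 1) (Eventually.of_forall fun t => ?_)
  have h1 := norm_sub_le (r : ℂ) (γ t)
  have h2 := Real.add_one_le_exp ‖γ t‖
  rw [Complex.norm_real, Real.norm_eq_abs] at h1
  rw [Real.norm_eq_abs, Real.abs_exp]
  nlinarith [abs_nonneg r, norm_nonneg (γ t)]

/-- In Lean `Γ` takes the value `0` at its poles. These are the zeros of the entire function `1/Γ`,
hence isolated by the identity theorem, as `1/Γ(1) ≠ 0`. -/
theorem Complex.eventually_Gamma_ne_zero (p : ℂ) :
    ∀ᶠ z in nhdsWithin p {p}ᶜ, Complex.Gamma z ≠ 0 := by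
  by_contra hne
  have hfreq : ∃ᶠ z in nhdsWithin p {p}ᶜ, (Complex.Gamma z)⁻¹ = 0 :=
    (not_eventually.1 hne).mono fun z hz => by rw [not_not.1 hz, inv_zero]
  have han : AnalyticOnNhd ℂ (fun z : ℂ => (Complex.Gamma z)⁻¹) Set.univ :=
    fun z _ => Complex.differentiable_one_div_Gamma.analyticAt z
  have := han.eqOn_zero_of_preconnected_of_frequently_eq_zero isPreconnected_univ
    (Set.mem_univ p) hfreq (Set.mem_univ 1)
  simp at this

section gammaQuotient

variable {ι κ : Type*} [Fintype ι] [Fintype κ] {a : ℝ} {ρ : κ → ℝ} {b θ : ι → ℝ} {γ : ℝ → ℂ}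

/-- Each linear factor costs at most a multiple of `exp |z|`, so the reciprocal Gamma factors are
taken with rate `K + card κ`. A single such factor already suffices, whence `Nonempty ι`. -/
theorem gammaQuotient_isBigO [Nonempty ι] (h : EndsInSectors (-1) γ) (hθ : ∀ j, 0 < θ j)
    {K : ℝ} (hK : 0 ≤ K) :
    (fun t => gammaQuotient a ρ b θ (γ t)) =O[cocompact ℝ] fun t => Real.exp (-K * ‖γ t‖) := by
  have h0 := h.affine one_pos a
  simp only [Complex.ofReal_one, one_mul] at h0
  have h1 := h0.Gamma_isBigO_one
  have h2 := Asymptotics.IsBigO.finsetProd (s := Finset.univ)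
    fun (k : κ) _ => sub_isBigO_exp_norm γ (ρ k)
  have h3 := Asymptotics.IsBigO.finsetProd (s := Finset.univ) fun (j : ι) _ =>
    h.inv_Gamma_reflect_isBigO (hθ j) (b j) (K := K + Fintype.card κ) (by positivity)
  simp only [gammaQuotient, inv_inv]
  refine (h1.mul (h2.mul h3)).trans ?_
  refine Asymptotics.IsBigO.of_bound 1 (Eventually.of_forall fun t => ?_)
  have hcard : (1 : ℝ) ≤ Fintype.card ι := by exact_mod_cast Fintype.card_pos
  simp only [one_mul, Finset.prod_const, Finset.card_univ, ← Real.exp_nat_mul, ← Real.exp_add,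
    Real.norm_eq_abs, Real.abs_exp]
  refine Real.exp_le_exp.2 ?_
  have : 0 ≤ ((Fintype.card ι : ℝ) - 1) * ((K + Fintype.card κ) * ‖γ t‖) :=
    mul_nonneg (by linarith) (by positivity)
  linarith

/-- On the right the roles are exchanged: `1/Γ(z+a)` supplies the decay, and the other factors of
the inverse are bounded. -/
theorem inv_gammaQuotient_isBigO (h : EndsInSectors 1 γ) (hθ : ∀ j, 0 < θ j)
    {K : ℝ} (hK : 0 ≤ K) :
    (fun t => (gammaQuotient a ρ b θ (γ t))⁻¹) =O[cocompact ℝ]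
      fun t => Real.exp (-K * ‖γ t‖) := by
  have h1 := h.inv_Gamma_add_isBigO a hK
  have h2 := Asymptotics.IsBigO.finsetProd (s := Finset.univ)
    fun (k : κ) _ => h.inv_sub_isBigO_one (ρ k)
  have h3 := Asymptotics.IsBigO.finsetProd (s := Finset.univ)
    fun (j : ι) _ => h.Gamma_reflect_isBigO_one (hθ j) (b j)
  simp only [gammaQuotient, mul_inv, inv_inv, Finset.prod_inv_distrib] at h2 h3 ⊢
  simpa using h1.mul (h2.mul h3)

theorem differentiable_gammaQuotient_entire_part (ρ : κ → ℝ) (b θ : ι → ℝ) :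
    Differentiable ℂ fun z : ℂ =>
      (∏ k, ((ρ k : ℂ) - z)) * ∏ j, (Complex.Gamma ((b j - z) / θ j))⁻¹ := by
  refine Differentiable.mul ?_ ?_
  · exact Differentiable.fun_finsetProd fun k _ => by fun_prop
  · refine Differentiable.fun_finsetProd fun j _ => ?_
    exact Complex.differentiable_one_div_Gamma.comp (by fun_prop)

theorem differentiable_inv_Gamma_add (a : ℝ) :
    Differentiable ℂ fun z : ℂ => (Complex.Gamma (z + a))⁻¹ :=
  Complex.differentiable_one_div_Gamma.comp (by fun_prop)

theorem gammaQuotient_entire_part_ne_zero (hρ : ∀ k, 1 / 2 < ρ k) (hb : ∀ j, 1 / 2 < b j)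
    (hθ : ∀ j, 0 < θ j) {p : ℂ} (hp : p.re < 1 / 2) :
    (∏ k, ((ρ k : ℂ) - p)) * ∏ j, (Complex.Gamma ((b j - p) / θ j))⁻¹ ≠ 0 := by
  refine mul_ne_zero (Finset.prod_ne_zero_iff.2 fun k _ h => ?_)
    (Finset.prod_ne_zero_iff.2 fun j _ => inv_ne_zero (Complex.Gamma_ne_zero_of_re_pos ?_))
  · have := congrArg Complex.re h
    simp at this; linarith [hρ k]
  · rw [Complex.div_ofReal_re]
    refine div_pos ?_ (hθ j)
    simp; linarith [hb j]

/-- Left of `1/2` the entire part does not vanish and cannot cancel a pole of `Γ(z+a)`, so the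
inverse is analytic with a zero at `p`. -/
theorem isPoleOf_gammaQuotient (hρ : ∀ k, 1 / 2 < ρ k) (hb : ∀ j, 1 / 2 < b j)
    (hθ : ∀ j, 0 < θ j) {p : ℂ} (hp : p.re < 1 / 2) (hp0 : (Complex.Gamma (p + a))⁻¹ = 0) :
    IsPoleOf (gammaQuotient a ρ b θ) p := by
  have hE := (differentiable_gammaQuotient_entire_part ρ b θ).analyticAt p
  have han : AnalyticAt ℂ (gammaQuotient a ρ b θ)⁻¹ p := by
    have := ((differentiable_inv_Gamma_add a).analyticAt p).mul
      (hE.inv (gammaQuotient_entire_part_ne_zero hρ hb hθ hp))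
    refine this.congr (Eventually.of_forall fun z => ?_)
    simp only [Pi.mul_apply, Pi.inv_apply, gammaQuotient, mul_inv, inv_inv]
  have h0 : (gammaQuotient a ρ b θ)⁻¹ p = 0 := by
    simp [gammaQuotient, hp0]
  have ht : Tendsto (gammaQuotient a ρ b θ)⁻¹ (nhdsWithin p {p}ᶜ) (nhds 0) := by
    rw [← h0]; exact han.continuousAt.tendsto.mono_left nhdsWithin_le_nhds
  have hpos := (tendsto_zero_iff_meromorphicOrderAt_pos han.meromorphicAt).1 ht
  rw [meromorphicOrderAt_inv] at hpos
  rw [IsPoleOf]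
  cases h : meromorphicOrderAt (gammaQuotient a ρ b θ) p with
  | top =>
    -- The order `⊤` is its own negative, so positivity of the order of the inverse does not exclude
    -- it; nonvanishing near `p` does.
    refine absurd h ((meromorphicOrderAt_ne_top_iff_eventually_ne_zero ?_).2 ?_)
    · simpa using han.meromorphicAt.inv
    · have hshift : Tendsto (fun z : ℂ => z + a) (nhdsWithin p {p}ᶜ)
          (nhdsWithin (p + a) {p + a}ᶜ) :=
        tendsto_nhdsWithin_of_tendsto_nhds_of_eventually_within _
          ((by fun_prop : Continuous fun z : ℂ => z + a).tendsto p |>.mono_left nhdsWithin_le_nhds)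
          (eventually_nhdsWithin_of_forall fun z hz => by simpa using hz)
      filter_upwards [hshift.eventually (Complex.eventually_Gamma_ne_zero (p + a)),
        nhdsWithin_le_nhds (hE.continuousAt.eventually_ne
          (gammaQuotient_entire_part_ne_zero hρ hb hθ hp))] with z h1 h2
      exact mul_ne_zero (inv_ne_zero (inv_ne_zero h1)) h2
  | coe n =>
    rw [h] at hpos
    have h1 : (0 : WithTop ℤ) < ((-n : ℤ) : WithTop ℤ) := hpos
    have h2 : 0 < -n := by exact_mod_cast h1
    exact_mod_cast (by linarith : n < 0)

theorem isZeroOf_gammaQuotient (ha : -1 / 2 < a) {p : ℂ} (hp : 1 / 2 < p.re)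
    (hp0 : (∏ k, ((ρ k : ℂ) - p)) * ∏ j, (Complex.Gamma ((b j - p) / θ j))⁻¹ = 0) :
    IsZeroOf (gammaQuotient a ρ b θ) p := by
  have hE := (differentiable_gammaQuotient_entire_part ρ b θ).analyticAt p
  have han : AnalyticAt ℂ (gammaQuotient a ρ b θ) p :=
    (((differentiable_inv_Gamma_add a).analyticAt p).inv
      (inv_ne_zero (Complex.Gamma_ne_zero_of_re_pos (by simp; linarith)))).mul hE
  have h0 : gammaQuotient a ρ b θ p = 0 := by
    rw [gammaQuotient, hp0, mul_zero]
  have ht : Tendsto (gammaQuotient a ρ b θ) (nhdsWithin p {p}ᶜ) (nhds 0) := by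
    rw [← h0]; exact han.continuousAt.tendsto.mono_left nhdsWithin_le_nhds
  exact (tendsto_zero_iff_meromorphicOrderAt_pos han.meromorphicAt).1 ht

end gammaQuotient

/-! ### Decay of `F` on `γ` and of `1 / F` on `γt` -/

theorem IsUpwardContour.exists_norm_mul_exp_le {σ : ℝ} {γ : ℝ → ℂ} (h : IsUpwardContour σ γ)
    {f : ℝ → ℂ} (hf : Continuous f)
    (hO : ∀ K : ℝ, 0 ≤ K → f =O[cocompact ℝ] fun t => Real.exp (-K * ‖γ t‖)) (K : ℝ) :
    ∃ C, ∀ t, ‖f t‖ * Real.exp (K * ‖γ t‖) ≤ C * Real.exp (-|t|) := by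
  obtain ⟨c, hc, hg⟩ := h.linear_growth
  -- The rate `|K|` pays for `exp(K |γ t|)`; the rate `1/c` yields `exp(-|t|)`, because `c |t| ≤ |γ
  -- t|` near infinity. Continuity covers the remaining compact set.
  obtain ⟨C, hC0, hC⟩ := (hO (|K| + 1 / c) (by positivity)).exists_nonneg
  rw [Asymptotics.isBigOWith_iff] at hC
  have hev : ∀ᶠ t in cocompact ℝ, ‖f t‖ * Real.exp (K * ‖γ t‖) * Real.exp |t| ≤ C := by
    filter_upwards [hC, hg] with t h1 h2
    rw [Real.norm_eq_abs, Real.abs_exp] at h1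
    have h3 : |t| ≤ 1 / c * ‖γ t‖ := by
      rw [one_div, ← div_eq_inv_mul, le_div_iff₀ hc]; linarith
    have h4 : K * ‖γ t‖ ≤ |K| * ‖γ t‖ :=
      mul_le_mul_of_nonneg_right (le_abs_self _) (norm_nonneg _)
    calc _ ≤ C * Real.exp (-(|K| + 1 / c) * ‖γ t‖) * Real.exp (K * ‖γ t‖) * Real.exp |t| := by
          gcongr
      _ = C * Real.exp (-(|K| + 1 / c) * ‖γ t‖ + K * ‖γ t‖ + |t|) := by
          rw [Real.exp_add, Real.exp_add]; ring
      _ ≤ C * 1 := by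
          refine mul_le_mul_of_nonneg_left (Real.exp_le_one_iff.2 ?_) hC0
          linarith
      _ = C := mul_one C
  have hcont : Continuous fun t => ‖f t‖ * Real.exp (K * ‖γ t‖) * Real.exp |t| := by
    have := h.continuous
    fun_prop
  obtain ⟨s, hs, hsC⟩ := mem_cocompact.1 hev
  obtain ⟨D, hD⟩ := hs.exists_bound_of_continuousOn hcont.continuousOn
  refine ⟨max C D, fun t => ?_⟩
  rw [Real.exp_neg, ← div_eq_mul_inv, le_div_iff₀ (Real.exp_pos _)]
  by_cases ht : t ∈ s
  · exact ((le_abs_self _).trans (hD t ht)).trans (le_max_right _ _)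
  · exact (hsC ht : _ ≤ C).trans (le_max_left _ _)

theorem Complex.Gamma_add_natCast_eq_prod_mul {w : ℂ} (hw : Complex.Gamma w ≠ 0) (n : ℕ) :
    Complex.Gamma (w + n) = (∏ i ∈ Finset.range n, (w + i)) * Complex.Gamma w := by
  induction n with
  | zero => simp
  | succ n ih =>
    have hne : w + n ≠ 0 := fun h =>
      hw ((Complex.Gamma_eq_zero_iff w).2 ⟨n, eq_neg_of_add_eq_zero_left h⟩)
    rw [Nat.cast_succ, ← add_assoc, Complex.Gamma_add_one _ hne, ih, Finset.prod_range_succ]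
    ring

/-- Turns the numerator Gamma factors of the truncated unitary model into polynomials. The
hypothesis excludes poles of `Γ(1+m-z)`, where its value in Lean is `0` while the left side may be
nonzero. -/
theorem Complex.Gamma_one_add_natCast_sub {m n : ℕ} (hmn : m < n) {z : ℂ}
    (hz : Complex.Gamma (1 + (m : ℂ) - z) ≠ 0) :
    Complex.Gamma (1 + (n : ℂ) - z) =
      (∏ i : Fin (n - m), (((m + 1 + i : ℝ) : ℂ) - z)) * Complex.Gamma (1 + (m : ℂ) - z) := by
  have h := Complex.Gamma_add_natCast_eq_prod_mul hz (n - m)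
  have h2 : 1 + (m : ℂ) - z + (n - m : ℕ) = 1 + (n : ℂ) - z := by
    push_cast [hmn.le]; ring
  rw [h2] at h
  rw [h, ← Fin.prod_univ_eq_prod_range (fun i => 1 + (m : ℂ) - z + i)]
  congr 1
  refine Finset.prod_congr rfl fun i _ => ?_
  push_cast; ring

/-- Cancelling Gamma factors is valid off a discrete set, so three forms of agreement are recorded:
equality left of `1/2`, for bounds on `γ`; equality up to a default value `0`, harmless for `1/F` on
`γt` since `0⁻¹ = 0`; and equality on punctured neighbourhoods, which transfers orders of poles and
zeros. -/
theorem HardEdgeModel.exists_gammaQuotient (M : HardEdgeModel) :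
    ∃ (ι κ : Type) (_ : Fintype ι) (_ : Fintype κ) (_ : Nonempty ι) (a : ℝ) (ρ : κ → ℝ)
      (b θ : ι → ℝ), -1 / 2 < a ∧ (∀ k, 1 / 2 < ρ k) ∧ (∀ j, 1 / 2 < b j) ∧ (∀ j, 0 < θ j) ∧
      (∀ z : ℂ, z.re < 1 / 2 → M.F z = gammaQuotient a ρ b θ z) ∧
      (∀ z, M.F z = gammaQuotient a ρ b θ z ∨ M.F z = 0) ∧
      ∀ p, M.F =ᶠ[nhdsWithin p {p}ᶜ] gammaQuotient a ρ b θ := by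
  rcases M with ⟨r, hr, ν⟩ | ⟨r, ν, J, hJ, μ, hμ⟩ | ⟨α, θ, hα, hθ⟩
  · have hF : ∀ z, (HardEdgeModel.ginibre r hr ν).F z =
        gammaQuotient 0 (fun k : Empty => k.elim) (fun j : Fin r => 1 + (ν j : ℝ)) (fun _ => 1) z := by
      intro z
      simp [HardEdgeModel.F, gammaQuotient, div_eq_mul_inv]
    refine ⟨Fin r, Empty, inferInstance, inferInstance, ⟨⟨0, hr⟩⟩, _, _, _, _, by norm_num, by simp,
      fun j => ?_, fun _ => one_pos, fun z _ => hF z, fun z => Or.inl (hF z),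
      fun p => Eventually.of_forall hF⟩
    have : (0 : ℝ) ≤ ν j := Nat.cast_nonneg _
    linarith
  · have hF : ∀ z, (∀ j, Complex.Gamma (1 + (ν j : ℂ) - z) ≠ 0) →
        (HardEdgeModel.truncatedUnitary r ν J hJ μ hμ).F z =
        gammaQuotient 0 (fun k : Σ k : J, Fin (μ k - ν k) => (ν k.1 + 1 + k.2 : ℝ))
          (fun j : (Jᶜ : Finset (Fin r)) => 1 + (ν j : ℝ)) (fun _ => 1) z := by
      intro z hz
      have h1 : ∏ k : J, Complex.Gamma (1 + (μ k : ℂ) - z) =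
          (∏ k : Σ k : J, Fin (μ k - ν k), (((ν k.1 + 1 + k.2 : ℝ) : ℂ) - z)) *
            ∏ j ∈ J, Complex.Gamma (1 + (ν j : ℂ) - z) := by
        rw [Fintype.prod_sigma, ← Finset.prod_coe_sort J fun j => Complex.Gamma (1 + (ν j : ℂ) - z),
          ← Finset.prod_mul_distrib]
        exact Finset.prod_congr rfl fun k _ => Complex.Gamma_one_add_natCast_sub (hμ k) (hz k)
      have h2 : ∏ j ∈ J, Complex.Gamma (1 + (ν j : ℂ) - z) ≠ 0 :=
        Finset.prod_ne_zero_iff.2 fun j _ => hz j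
      have h3 : ∏ j ∈ Jᶜ, Complex.Gamma (1 + (ν j : ℂ) - z) ≠ 0 :=
        Finset.prod_ne_zero_iff.2 fun j _ => hz j
      have h4 : ∏ j : (Jᶜ : Finset (Fin r)), (Complex.Gamma
          ((((1 + (ν j : ℝ) : ℝ) : ℂ) - z) / ((1 : ℝ) : ℂ)))⁻¹ =
          (∏ j ∈ Jᶜ, Complex.Gamma (1 + (ν j : ℂ) - z))⁻¹ := by
        rw [← Finset.prod_inv_distrib, ← Finset.prod_coe_sort Jᶜ]
        refine Finset.prod_congr rfl fun j _ => ?_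
        simp
      simp only [HardEdgeModel.F, gammaQuotient]
      rw [h1, h4, inv_inv, ← Finset.prod_mul_prod_compl J]
      simp only [Complex.ofReal_zero, add_zero]
      field_simp
    -- The factors indexed by `J` have cancelled; `|J| < r` leaves a reciprocal Gamma factor to
    -- produce decay.
    have hne : (Jᶜ : Finset (Fin r)).Nonempty := by
      rw [← Finset.card_pos, Finset.card_compl, Fintype.card_fin]; omega
    refine ⟨(Jᶜ : Finset (Fin r)), Σ k : J, Fin (μ k - ν k), inferInstance, inferInstance,
      hne.to_subtype, _, _, _, _, by norm_num, fun k => ?_,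
      fun j => ?_, fun _ => one_pos, fun z hz => hF z fun j => ?_, fun z => ?_, fun p => ?_⟩
    · have : (0 : ℝ) ≤ ν k.1 := Nat.cast_nonneg _
      have : (0 : ℝ) ≤ (k.2 : ℕ) := Nat.cast_nonneg _
      linarith
    · have : (0 : ℝ) ≤ ν j := Nat.cast_nonneg _
      linarith
    · refine Complex.Gamma_ne_zero_of_re_pos ?_
      have : (0 : ℝ) ≤ ν j := Nat.cast_nonneg _
      simp; linarith
    · by_cases hz : ∀ j, Complex.Gamma (1 + (ν j : ℂ) - z) ≠ 0
      · exact Or.inl (hF z hz)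
      · right
        push Not at hz
        obtain ⟨j, hj⟩ := hz
        simp only [HardEdgeModel.F]
        rw [Finset.prod_eq_zero (Finset.mem_univ j) hj, div_zero]
    · have : ∀ᶠ z in nhdsWithin p {p}ᶜ, ∀ j, Complex.Gamma (1 + (ν j : ℂ) - z) ≠ 0 := by
        refine eventually_all.2 fun j => ?_
        have ht : Tendsto (fun z : ℂ => 1 + (ν j : ℂ) - z) (nhdsWithin p {p}ᶜ)
            (nhdsWithin (1 + (ν j : ℂ) - p) {1 + (ν j : ℂ) - p}ᶜ) :=
          tendsto_nhdsWithin_of_tendsto_nhds_of_eventually_within _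
            ((by fun_prop : Continuous fun z : ℂ => 1 + (ν j : ℂ) - z).tendsto p
              |>.mono_left nhdsWithin_le_nhds)
            (eventually_nhdsWithin_of_forall fun z hz => by simpa using hz)
        exact ht.eventually (Complex.eventually_Gamma_ne_zero _)
      filter_upwards [this] with z hz using hF z hz
  · have hF : ∀ z, (HardEdgeModel.muttalibBorodin α θ hα hθ).F z =
        gammaQuotient (α / 2) (fun k : Empty => k.elim) (fun _ : Unit => α / 2 + 1) (fun _ => θ) z := by
      intro z
      simp [HardEdgeModel.F, gammaQuotient, div_eq_mul_inv]
    exact ⟨Unit, Empty, inferInstance, inferInstance, inferInstance, _, _, _, _, by linarith,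
      by simp, fun j => by linarith, fun _ => hθ, fun z _ => hF z, fun z => Or.inl (hF z),
      fun p => Eventually.of_forall hF⟩

theorem Complex.measurable_Gamma : Measurable Complex.Gamma := by
  have := Complex.differentiable_one_div_Gamma.continuous.measurable.inv
  simpa [Pi.inv_def] using this

theorem HardEdgeModel.measurable_F (M : HardEdgeModel) : Measurable M.F := by
  have hG := Complex.measurable_Gamma
  rcases M with ⟨r, hr, ν⟩ | ⟨r, ν, J, hJ, μ, hμ⟩ | ⟨α, θ, hα, hθ⟩
  · change Measurable fun z => Complex.Gamma z / ∏ j : Fin r, Complex.Gamma (1 + (ν j : ℂ) - z)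
    fun_prop
  · change Measurable fun z => (Complex.Gamma z * ∏ k : J, Complex.Gamma (1 + (μ k : ℂ) - z)) /
        ∏ j : Fin r, Complex.Gamma (1 + (ν j : ℂ) - z)
    fun_prop
  · change Measurable fun z =>
      Complex.Gamma (z + (α : ℂ) / 2) / Complex.Gamma (((α : ℂ) / 2 + 1 - z) / (θ : ℂ))
    fun_prop

theorem HardEdgeModel.exists_norm_F_le (M : HardEdgeModel) {γ γt : ℝ → ℂ}
    (hγ : AdmissibleContours M.F γ γt) (K : ℝ) :
    (∃ C, ∀ t, ‖M.F (γ t)‖ * Real.exp (K * ‖γ t‖) ≤ C * Real.exp (-|t|)) ∧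
      ∃ C, ∀ t, ‖(M.F (γt t))⁻¹‖ * Real.exp (K * ‖γt t‖) ≤ C * Real.exp (-|t|) := by
  obtain ⟨ι, κ, _, _, _, a, ρ, b, θ, ha, hρ, hb, hθ, hF1, hF2, hF3⟩ := M.exists_gammaQuotient
  have hEc := (differentiable_gammaQuotient_entire_part ρ b θ).continuous
  have hRc := (differentiable_inv_Gamma_add a).continuous
  constructor
  · have hc := hγ.left_contour.continuous
    -- A zero here would be a pole of `F` on the curve `γ`; dually, `hE` below excludes zeros of `F`
    -- on `γt`.
    have hR : ∀ t, (Complex.Gamma (γ t + a))⁻¹ ≠ 0 := by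
      intro t h0
      refine (hγ.poles (γ t) ?_).1 ⟨t, rfl⟩
      have := isPoleOf_gammaQuotient hρ hb hθ (hγ.re_lt t) h0
      rwa [IsPoleOf, ← meromorphicOrderAt_congr (hF3 _)] at this
    have hcont : Continuous fun t => gammaQuotient a ρ b θ (γ t) :=
      ((hRc.comp hc).inv₀ hR).mul (hEc.comp hc)
    obtain ⟨C, hC⟩ := hγ.left_contour.exists_norm_mul_exp_le hcont
      (fun K hK => gammaQuotient_isBigO (hγ.left_contour.endsInSectors (by simp)) hθ hK) K
    exact ⟨C, fun t => by rw [hF1 _ (hγ.re_lt t)]; exact hC t⟩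
  · have hc := hγ.right_contour.continuous
    have hE : ∀ t, (∏ k, ((ρ k : ℂ) - γt t)) *
        ∏ j, (Complex.Gamma ((b j - γt t) / θ j))⁻¹ ≠ 0 := by
      intro t h0
      refine (hγ.zeros (γt t) ?_).1 ⟨t, rfl⟩
      have := isZeroOf_gammaQuotient ha (hγ.lt_re t) h0
      rwa [IsZeroOf, ← meromorphicOrderAt_congr (hF3 _)] at this
    have hcont : Continuous fun t => (gammaQuotient a ρ b θ (γt t))⁻¹ := by
      have := (hRc.comp hc).mul ((hEc.comp hc).inv₀ hE)
      refine this.congr fun t => ?_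
      simp only [Pi.mul_apply, Pi.inv_apply, Function.comp_apply, gammaQuotient, mul_inv, inv_inv]
    obtain ⟨C, hC⟩ := hγ.right_contour.exists_norm_mul_exp_le hcont
      (fun K hK => inv_gammaQuotient_isBigO (hγ.right_contour.endsInSectors (by simp)) hθ hK) K
    refine ⟨C, fun t => le_trans ?_ (hC t)⟩
    refine mul_le_mul_of_nonneg_right ?_ (Real.exp_pos _).le
    rcases hF2 (γt t) with h | h
    · rw [h]
    · rw [h, inv_zero, norm_zero]; exact norm_nonneg _

/-- Near its ends `γ` lies in `Re z ≤ 0`, and on the remaining compact parameter set the real part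
attains a maximum below `1/2`. -/
theorem AdmissibleContours.exists_re_le {F : ℂ → ℂ} {γ γt : ℝ → ℂ}
    (hγ : AdmissibleContours F γ γt) : ∃ δ, 0 < δ ∧ ∀ t, (γ t).re ≤ 1 / 2 - δ := by
  obtain ⟨ε, hε, hs⟩ := hγ.left_contour.endsInSectors (by simp)
  obtain ⟨s, hs, hsC⟩ := mem_cocompact.1 (hs 1)
  have hc := hγ.left_contour.continuous
  rcases s.eq_empty_or_nonempty with rfl | hne
  · refine ⟨1 / 2, by norm_num, fun t => ?_⟩
    have := (hsC (by simp : t ∈ (∅ : Set ℝ)ᶜ)).2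
    have : 0 ≤ ε * |(γ t).im| := by positivity
    linarith
  · obtain ⟨t₀, -, ht₀⟩ := hs.exists_isMaxOn hne (Complex.continuous_re.comp hc).continuousOn
    have h0 := hγ.re_lt t₀
    refine ⟨min (1 / 2) (1 / 2 - (γ t₀).re), lt_min (by norm_num) (by linarith), fun t => ?_⟩
    by_cases ht : t ∈ s
    · have h1 : (γ t).re ≤ (γ t₀).re := ht₀ ht
      have := min_le_right (1 / 2) (1 / 2 - (γ t₀).re)
      linarith
    · have h1 := (hsC ht).2
      have : 0 ≤ ε * |(γ t).im| := by positivity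
      have := min_le_left (1 / 2) (1 / 2 - (γ t₀).re)
      linarith

/-! ### Integrals and bounds of exponentials and powers -/

theorem integrable_exp_neg_abs : Integrable fun t : ℝ => Real.exp (-|t|) := by
  rw [← integrableOn_univ, ← Set.Iic_union_Ioi (a := (0 : ℝ))]
  refine IntegrableOn.union ?_ ?_
  · refine (integrableOn_exp_Iic 0).congr_fun (fun t ht => ?_) measurableSet_Iic
    simp only [abs_of_nonpos (Set.mem_Iic.1 ht), neg_neg]
  · refine (integrableOn_exp_neg_Ioi 0).congr_fun (fun t ht => ?_) measurableSet_Ioi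
    simp only [abs_of_pos (Set.mem_Ioi.1 ht)]

theorem integrable_rpow_sub_half_mul {δ : ℝ} (hδ : 0 < δ) (s : ℝ) :
    Integrable (fun x : ℝ => x ^ (δ - 1 / 2) * x ^ (-1 / 2 : ℝ))
      (volume.restrict (Set.Ioc 0 s)) := by
  rcases le_or_gt s 0 with hs | hs
  · simp [Set.Ioc_eq_empty_of_le hs]
  have h1 := (intervalIntegral.intervalIntegrable_rpow' (a := 0) (b := s)
    (by linarith : -1 < δ - 1)).1
  refine IntegrableOn.congr_fun h1 (fun x hx => ?_) measurableSet_Ioc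
  rw [← Real.rpow_add hx.1]
  ring_nf

theorem integral_cpow_neg_mul_cpow {s : ℝ} (hs : 0 < s) {u z : ℂ} (huz : u.re < z.re) :
    ∫ x in Set.Ioc 0 s, (x : ℂ) ^ (-u) * (x : ℂ) ^ (z - 1) = (s : ℂ) ^ (z - u) / (z - u) := by
  have hne : z - u ≠ 0 := fun h0 => by
    have := congrArg Complex.re h0
    simp at this; linarith
  have h1 : ∫ x in Set.Ioc 0 s, (x : ℂ) ^ (-u) * (x : ℂ) ^ (z - 1) =
      ∫ x in Set.Ioc 0 s, (x : ℂ) ^ (z - u - 1) := by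
    refine setIntegral_congr_fun measurableSet_Ioc fun x hx => ?_
    have hx0 : (x : ℂ) ≠ 0 := by exact_mod_cast hx.1.ne'
    rw [← Complex.cpow_add _ _ hx0]
    ring_nf
  rw [h1, ← intervalIntegral.integral_of_le hs.le,
    integral_cpow (Or.inl (by simp only [Complex.sub_re, Complex.one_re]; linarith)),
    sub_add_cancel, Complex.ofReal_zero, Complex.zero_cpow hne, sub_zero]

/-- Separates `x` from `w`: since `x ≤ s`, the excess power `x^(Re w - c)` is at most `s^(Re w -
c)`, an exponential in `|w|` that the decay of `F` or `1/F` absorbs. -/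
theorem Complex.norm_ofReal_cpow_le {x s : ℝ} (hx : x ∈ Set.Ioc 0 s) {c : ℝ} {w : ℂ}
    (hc : c ≤ w.re) : ‖(x : ℂ) ^ w‖ ≤ x ^ c * Real.exp (|Real.log s| * (|c| + ‖w‖)) := by
  have hs : 0 < s := hx.1.trans_le hx.2
  rw [Complex.norm_cpow_eq_rpow_re_of_pos hx.1]
  calc x ^ w.re = x ^ c * x ^ (w.re - c) := by rw [← Real.rpow_add hx.1]; ring_nf
    _ ≤ x ^ c * s ^ (w.re - c) := by
        have := Real.rpow_le_rpow hx.1.le hx.2 (by linarith : 0 ≤ w.re - c)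
        exact mul_le_mul_of_nonneg_left this (Real.rpow_nonneg hx.1.le _)
    _ ≤ _ := by
        refine mul_le_mul_of_nonneg_left ?_ (Real.rpow_nonneg hx.1.le _)
        rw [Real.rpow_def_of_pos hs]
        refine Real.exp_le_exp.2 ?_
        have h1 : w.re - c ≤ |c| + ‖w‖ := by
          have := Complex.re_le_norm w
          have := neg_le_abs c
          linarith
        calc Real.log s * (w.re - c) ≤ |Real.log s| * (w.re - c) :=
              mul_le_mul_of_nonneg_right (le_abs_self _) (by linarith)
          _ ≤ _ := mul_le_mul_of_nonneg_left h1 (abs_nonneg _)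

/-! ### The factorization through `γt` and the conclusion -/

/-- The analytic input of the determinantal identity: two curves with bounded speed, separated by
the strip `1/2 - δ < Re z ≤ 1/2`, such that `F` on `γ` and `1 / F` on `γt` decay faster than every
exponential. -/
structure DecayingOnContours (F : ℂ → ℂ) (γ γt : ℝ → ℂ) (δ : ℝ) : Prop where
  measurable : Measurable F
  measurable_left : Measurable γ
  measurable_right : Measurable γt
  pos : 0 < δ
  re_le : ∀ t, (γ t).re ≤ 1 / 2 - δ
  lt_re : ∀ t, 1 / 2 < (γt t).re
  norm_deriv_left_le : ∃ C, ∀ t, ‖deriv γ t‖ ≤ C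
  norm_deriv_right_le : ∃ C, ∀ t, ‖deriv γt t‖ ≤ C
  decay_left : ∀ K, ∃ C, ∀ t, ‖F (γ t)‖ * Real.exp (K * ‖γ t‖) ≤ C * Real.exp (-|t|)
  decay_right : ∀ K, ∃ C, ∀ t, ‖(F (γt t))⁻¹‖ * Real.exp (K * ‖γt t‖) ≤ C * Real.exp (-|t|)

theorem HardEdgeModel.exists_decayingOnContours (M : HardEdgeModel) {γ γt : ℝ → ℂ}
    (hγ : AdmissibleContours M.F γ γt) : ∃ δ, DecayingOnContours M.F γ γt δ := by
  obtain ⟨δ, hδ, hre⟩ := hγ.exists_re_le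
  obtain ⟨C, hC⟩ := hγ.left_contour.lipschitz
  obtain ⟨D, hD⟩ := hγ.right_contour.lipschitz
  exact ⟨δ, M.measurable_F, hC.continuous.measurable, hD.continuous.measurable, hδ, hre, hγ.lt_re,
    ⟨C, fun _ => norm_deriv_le_of_lipschitz hC⟩, ⟨D, fun _ => norm_deriv_le_of_lipschitz hD⟩,
    fun K => (M.exists_norm_F_le hγ K).1, fun K => (M.exists_norm_F_le hγ K).2⟩

namespace DecayingOnContours

variable {F : ℂ → ℂ} {γ γt : ℝ → ℂ} {δ : ℝ}

theorem le_norm_sub (h : DecayingOnContours F γ γt δ) (t r : ℝ) : δ ≤ ‖γt t - γ r‖ := by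
  have h1 := Complex.re_le_norm (γt t - γ r)
  have h2 := h.re_le r
  have h3 := h.lt_re t
  simp only [Complex.sub_re] at h1
  linarith

/-- The denominator is at least `δ` in modulus, so the bound is uniform in `t`; `Re(-u) ≥ δ - 1/2`
gives the power of `x`. -/
theorem exists_norm_left_le (h : DecayingOnContours F γ γt δ) (s : ℝ) :
    ∃ C, 0 ≤ C ∧ ∀ x ∈ Set.Ioc 0 s, ∀ t r,
      ‖F (γ r) * (x : ℂ) ^ (-γ r) * deriv γ r / (γt t - γ r)‖ ≤
        C * x ^ (δ - 1 / 2) * Real.exp (-|r|) := by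
  obtain ⟨C, hC⟩ := h.decay_left |Real.log s|
  obtain ⟨D, hD⟩ := h.norm_deriv_left_le
  have hδ := h.pos
  have hC0 : 0 ≤ C := by
    have := (by positivity : 0 ≤ ‖F (γ 0)‖ * Real.exp (|Real.log s| * ‖γ 0‖)).trans (hC 0)
    simpa using this
  have hD0 : 0 ≤ D := (norm_nonneg _).trans (hD 0)
  refine ⟨C * Real.exp (|Real.log s| * |δ - 1 / 2|) * D / δ, by positivity, fun x hx t r => ?_⟩
  have h1 := Complex.norm_ofReal_cpow_le hx (c := δ - 1 / 2) (w := -γ r)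
    (by have := h.re_le r; simp only [Complex.neg_re]; linarith)
  rw [norm_neg, mul_add, Real.exp_add] at h1
  have hx0 := Real.rpow_nonneg hx.1.le (δ - 1 / 2)
  rw [norm_div, norm_mul, norm_mul]
  calc _ ≤ ‖F (γ r)‖ * (x ^ (δ - 1 / 2) * (Real.exp (|Real.log s| * |δ - 1 / 2|) *
          Real.exp (|Real.log s| * ‖γ r‖))) * D / δ := by
        gcongr
        · exact hD r
        · exact h.le_norm_sub t r
    _ = (‖F (γ r)‖ * Real.exp (|Real.log s| * ‖γ r‖)) *
          (x ^ (δ - 1 / 2) * Real.exp (|Real.log s| * |δ - 1 / 2|) * D / δ) := by ring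
    _ ≤ (C * Real.exp (-|r|)) *
          (x ^ (δ - 1 / 2) * Real.exp (|Real.log s| * |δ - 1 / 2|) * D / δ) := by
        exact mul_le_mul_of_nonneg_right (hC r) (by positivity)
    _ = _ := by ring

theorem exists_norm_right_le (h : DecayingOnContours F γ γt δ) (s : ℝ) :
    ∃ C, 0 ≤ C ∧ ∀ y ∈ Set.Ioc 0 s, ∀ t,
      ‖(y : ℂ) ^ (γt t - 1)‖ ≤
        y ^ (-1 / 2 : ℝ) * (C * Real.exp (|Real.log s| * ‖γt t‖)) := by
  -- `3/2 = |-1/2| + |1|`: the exponent of the power bound plus the shift in `v - 1`.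
  refine ⟨Real.exp (|Real.log s| * (3 / 2)), (Real.exp_pos _).le, fun y hy t => ?_⟩
  have h1 := Complex.norm_ofReal_cpow_le hy (c := -1 / 2) (w := γt t - 1)
    (by have := h.lt_re t; simp only [Complex.sub_re, Complex.one_re]; linarith)
  refine h1.trans (mul_le_mul_of_nonneg_left ?_ (Real.rpow_nonneg hy.1.le _))
  rw [← Real.exp_add]
  refine Real.exp_le_exp.2 ?_
  rw [← mul_add]
  refine mul_le_mul_of_nonneg_left ?_ (abs_nonneg _)
  have h2 := norm_sub_le (γt t) 1
  have h3 : |(-1 / 2 : ℝ)| = 1 / 2 := by norm_num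
  rw [norm_one] at h2
  rw [h3]; linarith

theorem exists_norm_inv_mul_deriv_le (h : DecayingOnContours F γ γt δ) (K : ℝ) :
    ∃ C, 0 ≤ C ∧ ∀ t, ‖(F (γt t))⁻¹ * deriv γt t‖ * Real.exp (K * ‖γt t‖) ≤
      C * Real.exp (-|t|) := by
  obtain ⟨C, hC⟩ := h.decay_right K
  obtain ⟨D, hD⟩ := h.norm_deriv_right_le
  have hD0 : 0 ≤ D := (norm_nonneg _).trans (hD 0)
  have hC0 : 0 ≤ C := by
    have := (by positivity : 0 ≤ ‖(F (γt 0))⁻¹‖ * Real.exp (K * ‖γt 0‖)).trans (hC 0)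
    simpa using this
  refine ⟨C * D, by positivity, fun t => ?_⟩
  rw [norm_mul]
  calc _ = (‖(F (γt t))⁻¹‖ * Real.exp (K * ‖γt t‖)) * ‖deriv γt t‖ := by ring
    _ ≤ (C * Real.exp (-|t|)) * D :=
        mul_le_mul (hC t) (hD t) (norm_nonneg _) (by positivity)
    _ = _ := by ring

theorem doubleContourIntegrable (h : DecayingOnContours F γ γt δ) {x y : ℝ} (hx : 0 < x)
    (hy : 0 < y) : DoubleContourIntegrable γ γt (limitIntegrand F x y) := by
  obtain ⟨C, hC0, hC⟩ := h.exists_norm_left_le x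
  obtain ⟨D, hD0, hD⟩ := h.exists_norm_right_le y
  obtain ⟨E, hE0, hE⟩ := h.exists_norm_inv_mul_deriv_le |Real.log y|
  have hF := h.measurable
  have h1 := h.measurable_left
  have h2 := h.measurable_right
  have h3 := measurable_deriv γ
  have h4 := measurable_deriv γt
  refine ((integrable_exp_neg_abs.mul_prod integrable_exp_neg_abs).const_mul
    ((C * x ^ (δ - 1 / 2)) * (y ^ (-1 / 2 : ℝ) * D * E))).mono' ?_
    (Eventually.of_forall fun z => ?_)
  · refine Measurable.aestronglyMeasurable ?_
    simp only [limitIntegrand]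
    fun_prop
  · have e : limitIntegrand F x y (γ z.1) (γt z.2) * deriv γt z.2 * deriv γ z.1 =
        -((F (γ z.1) * (x : ℂ) ^ (-γ z.1) * deriv γ z.1 / (γt z.2 - γ z.1)) *
          ((y : ℂ) ^ (γt z.2 - 1) * ((F (γt z.2))⁻¹ * deriv γt z.2))) := by
      rw [limitIntegrand, ← neg_sub (γt z.2) (γ z.1), div_neg]
      ring
    rw [e, norm_neg, norm_mul, norm_mul]
    have hy0 := Real.rpow_nonneg hy.le (-1 / 2)
    have hx0 := Real.rpow_nonneg hx.le (δ - 1 / 2)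
    calc _ ≤ (C * x ^ (δ - 1 / 2) * Real.exp (-|z.1|)) *
          (y ^ (-1 / 2 : ℝ) * (D * Real.exp (|Real.log y| * ‖γt z.2‖)) *
            ‖(F (γt z.2))⁻¹ * deriv γt z.2‖) := by
          gcongr
          · exact hC x ⟨hx, le_rfl⟩ _ _
          · exact hD y ⟨hy, le_rfl⟩ _
      _ = (C * x ^ (δ - 1 / 2) * Real.exp (-|z.1|)) * (y ^ (-1 / 2 : ℝ) * D *
            (‖(F (γt z.2))⁻¹ * deriv γt z.2‖ * Real.exp (|Real.log y| * ‖γt z.2‖))) := by ring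
      _ ≤ (C * x ^ (δ - 1 / 2) * Real.exp (-|z.1|)) * (y ^ (-1 / 2 : ℝ) * D *
            (E * Real.exp (-|z.2|))) := by
          exact mul_le_mul_of_nonneg_left (mul_le_mul_of_nonneg_left (hE _) (by positivity))
            (by positivity)
      _ = _ := by ring

theorem contourIntegrable_mellinIntegrand (h : DecayingOnContours F γ γt δ) {s : ℝ} (hs : 0 < s)
    (t t' : ℝ) : ContourIntegrable γ (mellinIntegrand F s (γt t) (γt t')) := by
  -- At `x = s` the bounded integrand contains `F(u) s^(-u) / (v-u)`; the remaining factor `1/(z-u)`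
  -- is at most `1/δ`.
  obtain ⟨C, hC0, hC⟩ := h.exists_norm_left_le s
  have hF := h.measurable
  have h1 := h.measurable_left
  have h3 := measurable_deriv γ
  have hs' : (s : ℂ) ≠ 0 := by exact_mod_cast hs.ne'
  refine (integrable_exp_neg_abs.const_mul
    (C * s ^ (δ - 1 / 2) * (‖(s : ℂ) ^ γt t'‖ * ‖(F (γt t))⁻¹‖ / δ))).mono' ?_
    (Eventually.of_forall fun r => ?_)
  · refine Measurable.aestronglyMeasurable ?_
    simp only [mellinIntegrand]
    fun_prop
  · have e : mellinIntegrand F s (γt t) (γt t') (γ r) * deriv γ r =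
        (F (γ r) * (s : ℂ) ^ (-γ r) * deriv γ r / (γt t - γ r)) *
          ((s : ℂ) ^ γt t' * (F (γt t))⁻¹ / (γt t' - γ r)) := by
      rw [mellinIntegrand, sub_eq_add_neg (γt t') (γ r), Complex.cpow_add _ _ hs', div_eq_mul_inv,
        mul_inv, mul_inv]
      ring
    rw [e, norm_mul, norm_div (_ * _) (γt t' - γ r), norm_mul ((s : ℂ) ^ γt t')]
    have hs0 := Real.rpow_nonneg hs.le (δ - 1 / 2)
    have hδ := h.pos
    calc _ ≤ (C * s ^ (δ - 1 / 2) * Real.exp (-|r|)) *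
          (‖(s : ℂ) ^ γt t'‖ * ‖(F (γt t))⁻¹‖ / δ) := by
          gcongr
          · exact hC s ⟨hs, le_rfl⟩ _ _
          · exact h.le_norm_sub t' r
      _ = _ := by ring

end DecayingOnContours

/-- The factor `A` of the factorization `𝕂 = A B`, `B(t, y) = y ^ (γt t - 1)`, in the real
parameter of the contour `γt`. -/
noncomputable def leftFactor (F : ℂ → ℂ) (γ γt : ℝ → ℂ) (x t : ℝ) : ℂ :=
  (1 / (2 * (Real.pi : ℂ) * Complex.I)) ^ 2 * ((F (γt t))⁻¹ * deriv γt t) *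
    ∫ r : ℝ, F (γ r) * (x : ℂ) ^ (-γ r) * deriv γ r / (γt t - γ r)

namespace DecayingOnContours

variable {F : ℂ → ℂ} {γ γt : ℝ → ℂ} {δ : ℝ}

theorem measurable_leftFactor (h : DecayingOnContours F γ γt δ) :
    Measurable (Function.uncurry (leftFactor F γ γt)) := by
  have hF := h.measurable
  have h1 := h.measurable_left
  have h2 := h.measurable_right
  have h3 := measurable_deriv γ
  have h4 := measurable_deriv γt
  have hm : Measurable (Function.uncurry fun (z : ℝ × ℝ) (r : ℝ) =>
      F (γ r) * (z.1 : ℂ) ^ (-γ r) * deriv γ r / (γt z.2 - γ r)) := by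
    simp only [Function.uncurry_def]
    fun_prop
  have hi := (hm.stronglyMeasurable.integral_prod_right (ν := volume)).measurable
  simp only [Function.uncurry_def, leftFactor]
  fun_prop

theorem exists_norm_leftFactor_le (h : DecayingOnContours F γ γt δ) (s : ℝ) :
    ∃ C, 0 ≤ C ∧ ∀ x ∈ Set.Ioc 0 s, ∀ t,
      ‖leftFactor F γ γt x t‖ ≤ x ^ (δ - 1 / 2) * (C * ‖(F (γt t))⁻¹ * deriv γt t‖) := by
  obtain ⟨C, hC0, hC⟩ := h.exists_norm_left_le s
  have hI : 0 ≤ ∫ r : ℝ, Real.exp (-|r|) := integral_nonneg fun r => (Real.exp_pos _).le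
  refine ⟨‖(1 / (2 * (Real.pi : ℂ) * Complex.I)) ^ 2‖ * (C * ∫ r : ℝ, Real.exp (-|r|)),
    by positivity, fun x hx t => ?_⟩
  have h1 : ‖∫ r : ℝ, F (γ r) * (x : ℂ) ^ (-γ r) * deriv γ r / (γt t - γ r)‖ ≤
      C * x ^ (δ - 1 / 2) * ∫ r : ℝ, Real.exp (-|r|) := by
    rw [← integral_const_mul]
    exact norm_integral_le_of_norm_le (integrable_exp_neg_abs.const_mul _)
      (Eventually.of_forall fun r => hC x hx t r)
  rw [leftFactor, norm_mul, norm_mul]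
  refine (mul_le_mul_of_nonneg_left h1 (by positivity)).trans (le_of_eq ?_)
  ring

theorem limitKernel_eq (h : DecayingOnContours F γ γt δ) {x y : ℝ} (hx : 0 < x) (hy : 0 < y) :
    limitKernel F γ γt x y =
      ∫ t : ℝ, leftFactor F γ γt x t * (y : ℂ) ^ (γt t - 1) := by
  have hint := h.doubleContourIntegrable hx hy
  -- The sign from `(2πi)² = -4π²` compensates for replacing `u - v` by `v - u`.
  have hconst : (1 / (2 * (Real.pi : ℂ) * Complex.I)) ^ 2 = -(1 / (4 * (Real.pi : ℂ) ^ 2)) := by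
    rw [div_pow, mul_pow, Complex.I_sq]; ring
  simp only [limitKernel, contourIntegral]
  simp_rw [← integral_mul_const]
  rw [integral_integral_swap (f := fun r t =>
    limitIntegrand F x y (γ r) (γt t) * deriv γt t * deriv γ r) hint, ← integral_const_mul]
  refine integral_congr_ae (Eventually.of_forall fun t => ?_)
  simp only [leftFactor]
  rw [← integral_const_mul, ← integral_const_mul, ← integral_mul_const]
  refine integral_congr_ae (Eventually.of_forall fun r => ?_)
  simp only [limitIntegrand]
  rw [hconst, ← neg_sub (γt t) (γ r), div_neg]
  ring

theorem integrable_left_mul_cpow (h : DecayingOnContours F γ γt δ) (s : ℝ) (t t' : ℝ) :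
    Integrable (fun z : ℝ × ℝ => F (γ z.2) * (z.1 : ℂ) ^ (-γ z.2) * deriv γ z.2 / (γt t - γ z.2) *
      (z.1 : ℂ) ^ (γt t' - 1)) ((volume.restrict (Set.Ioc 0 s)).prod volume) := by
  obtain ⟨C, hC0, hC⟩ := h.exists_norm_left_le s
  obtain ⟨D, hD0, hD⟩ := h.exists_norm_right_le s
  have hF := h.measurable
  have h1 := h.measurable_left
  have h3 := measurable_deriv γ
  refine (((integrable_rpow_sub_half_mul h.pos s).mul_prod integrable_exp_neg_abs).const_mul
    (C * (D * Real.exp (|Real.log s| * ‖γt t'‖)))).mono' ?_ ?_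
  · refine Measurable.aestronglyMeasurable ?_
    fun_prop
  · have hS : ∀ᵐ z ∂((volume.restrict (Set.Ioc 0 s)).prod (volume : Measure ℝ)),
        z.1 ∈ Set.Ioc 0 s :=
      Measure.quasiMeasurePreserving_fst.ae (ae_restrict_mem measurableSet_Ioc)
    filter_upwards [hS] with z hz
    have hx0 := Real.rpow_nonneg hz.1.le (δ - 1 / 2)
    rw [norm_mul]
    refine (mul_le_mul (hC _ hz t z.2) (hD _ hz t') (norm_nonneg _) (by positivity)).trans
      (le_of_eq ?_)
    ring

/-- Fubini lets the `x`-integral be done first, producing `s^(z-u)/(z-u)`. Of the two factors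
`1/(2πi)` in `leftFactor`, one belongs to `ℍ_s` and one to the measure `dv/(2πi)`. -/
theorem contourOperatorKernel_mellinKernel_eq (h : DecayingOnContours F γ γt δ) {s : ℝ}
    (hs : 0 < s) (t t' : ℝ) :
    contourOperatorKernel γt (mellinKernel F γ s) t t' =
      ∫ x in Set.Ioc 0 s, leftFactor F γ γt x t * (x : ℂ) ^ (γt t' - 1) := by
  have hint := h.integrable_left_mul_cpow s t t'
  have h1 : ∀ x : ℝ, leftFactor F γ γt x t * (x : ℂ) ^ (γt t' - 1) =
      (1 / (2 * (Real.pi : ℂ) * Complex.I)) ^ 2 * ((F (γt t))⁻¹ * deriv γt t) *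
        ∫ r : ℝ, F (γ r) * (x : ℂ) ^ (-γ r) * deriv γ r / (γt t - γ r) *
          (x : ℂ) ^ (γt t' - 1) := by
    intro x
    rw [leftFactor, mul_assoc, ← integral_mul_const]
  simp_rw [h1]
  rw [integral_const_mul, integral_integral_swap (f := fun x r : ℝ =>
    F (γ r) * (x : ℂ) ^ (-γ r) * deriv γ r / (γt t - γ r) * (x : ℂ) ^ (γt t' - 1)) hint]
  have h2 : ∀ r : ℝ, ∫ x in Set.Ioc 0 s, F (γ r) * (x : ℂ) ^ (-γ r) * deriv γ r / (γt t - γ r) *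
      (x : ℂ) ^ (γt t' - 1) =
      F (γ r) * deriv γ r / (γt t - γ r) * ((s : ℂ) ^ (γt t' - γ r) / (γt t' - γ r)) := by
    intro r
    rw [← integral_cpow_neg_mul_cpow hs (u := γ r) (z := γt t')
      (by linarith [h.re_le r, h.lt_re t', h.pos]), ← integral_const_mul]
    refine integral_congr_ae (Eventually.of_forall fun x => ?_)
    simp only
    ring
  simp_rw [h2]
  rw [contourOperatorKernel, mellinKernel, contourIntegral, mul_assoc, ← integral_mul_const,
    ← integral_const_mul, ← integral_const_mul]
  refine integral_congr_ae (Eventually.of_forall fun r => ?_)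
  simp only [mellinIntegrand, div_eq_mul_inv, mul_inv]
  ring

theorem fredholm (h : DecayingOnContours F γ γt δ) {s : ℝ} (hs : 0 < s) :
    FredholmConverges (volume.restrict (Set.Icc 0 s)) (limitKernel F γ γt) ∧
    FredholmConverges volume (contourOperatorKernel γt (mellinKernel F γ s)) ∧
    fredholmDet (volume.restrict (Set.Icc 0 s)) (limitKernel F γ γt) =
      fredholmDet volume (contourOperatorKernel γt (mellinKernel F γ s)) := by
  obtain ⟨C, hC0, hC⟩ := h.exists_norm_leftFactor_le s
  obtain ⟨D, hD0, hD⟩ := h.exists_norm_right_le s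
  obtain ⟨E, hE0, hE⟩ := h.exists_norm_inv_mul_deriv_le |Real.log s|
  have hF := h.measurable
  have h2 := h.measurable_right
  have h4 := measurable_deriv γt
  -- The endpoint `0` is null, and the power bounds require `x > 0`.
  rw [← restrict_Ioc_eq_restrict_Icc]
  refine fredholm_comp_comm _ _ (leftFactor F γ γt) (fun t y => (y : ℂ) ^ (γt t - 1)) _ _
    h.measurable_leftFactor ?_ (ae_restrict_mem measurableSet_Ioc)
    (p := fun x => x ^ (δ - 1 / 2)) (q := fun x => x ^ (-1 / 2 : ℝ))
    (g := fun t => C * ‖(F (γt t))⁻¹ * deriv γt t‖)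
    (h := fun t => D * Real.exp (|Real.log s| * ‖γt t‖))
    (fun x hx => Real.rpow_pos_of_pos hx.1 _) (fun x hx => Real.rpow_pos_of_pos hx.1 _)
    hC (fun t y hy => hD y hy t) (integrable_rpow_sub_half_mul h.pos s) ?_
    (fun x hx y hy => h.limitKernel_eq hx.1 hy.1)
    (h.contourOperatorKernel_mellinKernel_eq hs)
  · simp only [Function.uncurry_def]
    fun_prop
  -- The growth `exp(|log s| |v|)` of `B` is beaten by the decay of `1/F(v)` carried by `A`.
  · refine (integrable_exp_neg_abs.const_mul (C * D * E)).mono' ?_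
      (Eventually.of_forall fun t => ?_)
    · refine Measurable.aestronglyMeasurable ?_
      fun_prop
    · rw [Real.norm_eq_abs, abs_of_nonneg (by positivity)]
      calc _ = C * D * (‖(F (γt t))⁻¹ * deriv γt t‖ * Real.exp (|Real.log s| * ‖γt t‖)) := by ring
        _ ≤ C * D * (E * Real.exp (-|t|)) := mul_le_mul_of_nonneg_left (hE t) (by positivity)
        _ = _ := by ring

end DecayingOnContours

theorem proposition2p1 (M : HardEdgeModel) (γ γt : ℝ → ℂ) (hγ : AdmissibleContours M.F γ γt)
    (s : ℝ) (hs : 0 < s) :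
    (∀ x y : ℝ, 0 < x → 0 < y → DoubleContourIntegrable γ γt (limitIntegrand M.F x y)) ∧
    (∀ v ∈ Set.range γt, ∀ z ∈ Set.range γt, ContourIntegrable γ (mellinIntegrand M.F s v z)) ∧
    FredholmConverges (MeasureTheory.volume.restrict (Set.Icc 0 s)) (limitKernel M.F γ γt) ∧
    FredholmConverges MeasureTheory.volume
      (contourOperatorKernel γt (mellinKernel M.F γ s)) ∧
    fredholmDet (MeasureTheory.volume.restrict (Set.Icc 0 s)) (limitKernel M.F γ γt) =
      fredholmDet MeasureTheory.volume (contourOperatorKernel γt (mellinKernel M.F γ s)) := by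
  obtain ⟨δ, h⟩ := M.exists_decayingOnContours hγ
  refine ⟨fun x y hx hy => h.doubleContourIntegrable hx hy, ?_, h.fredholm hs⟩
  rintro _ ⟨t, rfl⟩ _ ⟨t', rfl⟩
  exact h.contourIntegrable_mellinIntegrand hs t t'
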